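/- Let $X$ be a connected simple graph of bounded valency with vertex set $VX$ and set of oriented edges $\mathrm{OE}$; for $e\in\mathrm{OE}$ let $o(e)$ and $t(e)$ be its initial and terminal vertex and $e^{-1}$ its reverse. Let $w:\mathrm{OE}\to(0,\infty)$ be a weight function of finite total weight $\sum_{e\in\mathrm{OE}}w(e)<\infty$. A cycle is a closed path of positive length without backtracking and without tail, considered up to cyclic shifts; it is prime if it is not a proper power of a shorter one. For a cycle $p$ let $l(p)$ be its length and $w(p)$ the product of the weights of its oriented edges, and let $Z(u)=\prod_p(1-w(p)u^{l(p)})^{-1}$, the product over all prime cycles. On $C_0=\ell^2(VX)$ and $C_1=\ell^2(\mathrm{OE})$ let $\sigma:C_0\to C_1$, $\tau:C_1\to C_0$, $J:C_1\to C_1$ and $A,B_2:C_0\to C_0$ be the bounded operators with $$\sigma(x)=\sum_{o(e)=x}w(e)\,e,\quad \tau(e)=t(e),\quad J(e)=w(e^{-1})\,e^{-1},\quad A(x)=\sum_{x'\sim x}w(x,x')\,x',\quad B_2(x)=\sum_{x'\sim x}w(x,x')w(x',x)\,x.$$ **Bass–Ihara formula.** For $|u|$ sufficiently small the product $Z(u)$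 converges to a nonzero number, $Z(u)^{-1}$ extends to an entire function of $u\in\mathbb C$, and for every $u\in\mathbb C$ the operator $u\begin{pmatrix}uB_2-A & u\tau J^2\\ \sigma & J\end{pmatrix}$ on $C_0\oplus C_1$ is of trace class and $$Z(u)^{-1}=\det\left[1+u\begin{pmatrix}uB_2-A & u\tau J^2\\ \sigma & J\end{pmatrix}\right],$$ where $\det(1+S)=\sum_{k\ge0}\operatorname{tr}\bigwedge^kS$ is the Fredholm determinant of a trace class operator $S$. -/

import Mathlib

open scoped ENNReal NNReal InnerProductSpace

/-! ### Trace class operators and the Fredholm determinant -/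

section Fredholm

variable {H : Type*} [NormedAddCommGroup H] [InnerProductSpace ℂ H]

/-- A bounded operator `T` on a complex Hilbert space is of trace class (equivalently, nuclear) if
`T = ∑ₙ ⟪xₙ, ·⟫ yₙ` for some vectors with `∑ₙ ‖xₙ‖ ‖yₙ‖ < ∞`. -/
def IsTraceClass (T : H →L[ℂ] H) : Prop :=
  ∃ x y : ℕ → H, Summable (fun n => ‖x n‖ * ‖y n‖) ∧
    ∀ v : H, HasSum (fun n => ⟪x n, v⟫_ℂ • y n) (T v)

/-- For `v : Fin k → H` and `ω ∈ ⋀ᵏ H`, the inner product `⟪v₁ ∧ ⋯ ∧ vₖ, ω⟫` on the exterior power,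
i.e. the value at `ω` of the functional `⟪v₁, ·⟫ ∧ ⋯ ∧ ⟪vₖ, ·⟫`. -/
noncomputable def wedgeInner {k : ℕ} (v : Fin k → H) (ω : ⋀[ℂ]^k H) : ℂ :=
  exteriorPower.pairingDual ℂ H k
    (exteriorPower.ιMulti ℂ k fun i => (innerSL ℂ (v i)).toLinearMap) ω

/-- On decomposable elements this inner product is the Gram determinant. -/
theorem wedgeInner_ιMulti {k : ℕ} (v u : Fin k → H) :
    wedgeInner v (exteriorPower.ιMulti ℂ k u) = (Matrix.of fun i j => ⟪v j, u i⟫_ℂ).det := by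
  simp [wedgeInner]

/-- `tr ⋀ᵏ T = t`. If `(bᵢ)` is an orthonormal basis of `H`, the wedge products
`b_s = b_{s₁} ∧ ⋯ ∧ b_{sₖ}` over the `k`-element subsets `s` of the index set form an orthonormal
basis of the Hilbert space `⋀ᵏ H`, and the trace is `∑ₛ ⟪b_s, (⋀ᵏ T) b_s⟫`. (The summand does not
depend on the enumeration of `s`.) The sum is required to have the same value in all bases. -/
def HasExteriorTrace [CompleteSpace H] (k : ℕ) (T : H →L[ℂ] H) (t : ℂ) : Prop :=
  ∀ (ι : Set H) (b : HilbertBasis ι ℂ H),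
    HasSum (fun s : {s : Finset ι // s.card = k} =>
      let v : Fin k → H := fun i => b ((s.1.equivFinOfCardEq s.2).symm i)
      wedgeInner v (exteriorPower.map k T.toLinearMap (exteriorPower.ιMulti ℂ k v))) t

/-- `d` is the Fredholm determinant `det (1 + T) = ∑ₖ tr ⋀ᵏ T` of the trace class operator `T`. -/
def HasFredholmDet [CompleteSpace H] (T : H →L[ℂ] H) (d : ℂ) : Prop :=
  IsTraceClass T ∧ ∃ t : ℕ → ℂ, (∀ k, HasExteriorTrace k T (t k)) ∧ HasSum t d

end Fredholm

/-! ### Bounded operators between `ℓ²`-spaces given by matrices -/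

section MatrixOp

/-- The Hilbert space `ℓ²(ι)` with its standard basis `(lp.single 2 i 1)`. -/
abbrev EllTwo (ι : Type*) : Type _ := lp (fun _ : ι => ℂ) 2

variable {ι κ : Type*}

/-- All absolute row and column sums of the matrix are bounded by one constant. -/
def SchurBounded (a : κ → ι → ℂ) : Prop :=
  ∃ C : ℝ≥0, (∀ k, ∑' i, ‖a k i‖ₑ ≤ C) ∧ ∀ i, ∑' k, ‖a k i‖ₑ ≤ C

theorem EllTwo.enorm_sq (f : EllTwo ι) : ‖f‖ₑ ^ 2 = ∑' i, ‖f i‖ₑ ^ 2 := by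
  have h := lp.hasSum_norm (p := 2) (by norm_num) f
  simp only [ENNReal.toReal_ofNat, Real.rpow_ofNat] at h
  simp only [← ofReal_norm, ← ENNReal.ofReal_pow (norm_nonneg _)]
  rw [← h.tsum_eq, ENNReal.ofReal_tsum_of_nonneg (fun _ => by positivity) h.summable]

theorem ENNReal.tsum_mul_sq_le (a f : ι → ℝ≥0∞) :
    (∑' i, a i * f i) ^ 2 ≤ (∑' i, a i) * ∑' i, a i * f i ^ 2 := by
  have key : ∑' i, a i * f i ≤ (∑' i, a i) ^ (1 / 2 : ℝ) * (∑' i, a i * f i ^ 2) ^ (1 / 2 : ℝ) := by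
    rw [ENNReal.tsum_eq_iSup_sum]
    refine iSup_le fun s => ?_
    have h := ENNReal.inner_le_weight_mul_Lp_of_nonneg s (p := 2) (by norm_num) a f
    norm_num at h
    refine h.trans ?_
    gcongr
    · exact ENNReal.sum_le_tsum s
    · exact ENNReal.sum_le_tsum s
  calc (∑' i, a i * f i) ^ 2
      ≤ ((∑' i, a i) ^ (1 / 2 : ℝ) * (∑' i, a i * f i ^ 2) ^ (1 / 2 : ℝ)) ^ 2 := by gcongr
    _ = _ := by
      rw [mul_pow, ← ENNReal.rpow_natCast, ← ENNReal.rpow_natCast, ← ENNReal.rpow_mul,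
        ← ENNReal.rpow_mul]
      norm_num

theorem SchurBounded.tsum_row_sq_le {a : κ → ι → ℂ} {C : ℝ≥0} (hr : ∀ k, ∑' i, ‖a k i‖ₑ ≤ C)
    (hc : ∀ i, ∑' k, ‖a k i‖ₑ ≤ C) (f : EllTwo ι) :
    ∑' k, (∑' i, ‖a k i * f i‖ₑ) ^ 2 ≤ ((C : ℝ≥0∞) * ‖f‖ₑ) ^ 2 := by
  calc ∑' k, (∑' i, ‖a k i * f i‖ₑ) ^ 2
      ≤ ∑' k, (C : ℝ≥0∞) * ∑' i, ‖a k i‖ₑ * ‖f i‖ₑ ^ 2 := by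
        refine ENNReal.tsum_le_tsum fun k => ?_
        simp only [enorm_mul]
        refine (ENNReal.tsum_mul_sq_le _ _).trans ?_
        gcongr
        exact hr k
    _ = (C : ℝ≥0∞) * ∑' i, (∑' k, ‖a k i‖ₑ) * ‖f i‖ₑ ^ 2 := by
        rw [ENNReal.tsum_mul_left, ENNReal.tsum_comm]
        simp only [ENNReal.tsum_mul_right]
    _ ≤ (C : ℝ≥0∞) * ∑' i, (C : ℝ≥0∞) * ‖f i‖ₑ ^ 2 := by
        gcongr with i
        exact hc i
    _ = _ := by rw [ENNReal.tsum_mul_left, ← EllTwo.enorm_sq]; ring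

theorem SchurBounded.summable_row {a : κ → ι → ℂ} (ha : SchurBounded a) (f : EllTwo ι) (k : κ) :
    Summable fun i => a k i * f i := by
  obtain ⟨C, hr, hc⟩ := ha
  have h := (ENNReal.le_tsum k).trans (SchurBounded.tsum_row_sq_le hr hc f)
  have hlt : ((C : ℝ≥0∞) * ‖f‖ₑ) ^ 2 < ⊤ :=
    ENNReal.pow_lt_top (ENNReal.mul_lt_top ENNReal.coe_lt_top enorm_lt_top)
  have h2 : ∑' i, ‖a k i * f i‖ₑ ≠ ⊤ := by
    intro h0
    rw [h0] at h
    exact absurd (h.trans_lt hlt) (by simp)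
  refine Summable.of_nnnorm ?_
  exact ENNReal.tsum_coe_ne_top_iff_summable.mp h2

theorem SchurBounded.tsum_sq_le {a : κ → ι → ℂ} {C : ℝ≥0} (hr : ∀ k, ∑' i, ‖a k i‖ₑ ≤ C)
    (hc : ∀ i, ∑' k, ‖a k i‖ₑ ≤ C) (f : EllTwo ι) :
    ∑' k, ‖∑' i, a k i * f i‖ₑ ^ 2 ≤ ((C : ℝ≥0∞) * ‖f‖ₑ) ^ 2 := by
  refine le_trans (ENNReal.tsum_le_tsum fun k => ?_) (SchurBounded.tsum_row_sq_le hr hc f)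
  gcongr
  exact enorm_tsum_le_tsum_enorm

theorem SchurBounded.memℓp {a : κ → ι → ℂ} (ha : SchurBounded a) (f : EllTwo ι) :
    Memℓp (fun k => ∑' i, a k i * f i) 2 := by
  obtain ⟨C, hr, hc⟩ := ha
  have hlt : ∑' k, ‖∑' i, a k i * f i‖ₑ ^ 2 ≠ ⊤ := ((SchurBounded.tsum_sq_le hr hc f).trans_lt
    (ENNReal.pow_lt_top (ENNReal.mul_lt_top ENNReal.coe_lt_top enorm_lt_top))).ne
  refine memℓp_gen ?_
  simp only [ENNReal.toReal_ofNat, Real.rpow_ofNat]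
  have h1 : Summable fun k => ‖∑' i, a k i * f i‖₊ ^ 2 := by
    refine ENNReal.tsum_coe_ne_top_iff_summable.mp ?_
    simp only [ENNReal.coe_pow]
    exact hlt
  have h2 := NNReal.summable_coe.mpr h1
  simp only [NNReal.coe_pow, coe_nnnorm] at h2
  exact h2

/-- The bounded operator `ℓ²(ι) → ℓ²(κ)` with matrix `a`: `a k i` is the coefficient of the basis
vector `k` in the image of the basis vector `i`. -/
noncomputable def matrixOp (a : κ → ι → ℂ) (ha : SchurBounded a) : EllTwo ι →L[ℂ] EllTwo κ :=
  LinearMap.mkContinuousOfExistsBound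
    { toFun := fun f => ⟨fun k => ∑' i, a k i * f i, ha.memℓp f⟩
      map_add' := fun f g => by
        ext k
        simp only [lp.coeFn_add, Pi.add_apply, mul_add]
        exact (ha.summable_row f k).tsum_add (ha.summable_row g k)
      map_smul' := fun c f => by
        ext k
        simp only [lp.coeFn_smul, Pi.smul_apply, smul_eq_mul, RingHom.id_apply, mul_left_comm _ c]
        exact tsum_mul_left }
    (by
      obtain ⟨C, hr, hc⟩ := id ha
      refine ⟨C, fun f => ?_⟩
      have h := SchurBounded.tsum_sq_le hr hc f
      set g : EllTwo κ := ⟨fun k => ∑' i, a k i * f i, ha.memℓp f⟩ with hg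
      have h1 : ‖g‖ₑ ^ 2 ≤ ((C : ℝ≥0∞) * ‖f‖ₑ) ^ 2 := by rw [EllTwo.enorm_sq]; exact h
      have h2 : ‖g‖ₑ ≤ (C : ℝ≥0∞) * ‖f‖ₑ := (ENNReal.pow_le_pow_left_iff two_ne_zero).mp h1
      have h3 : ‖g‖₊ ≤ C * ‖f‖₊ := by
        rw [← ENNReal.coe_le_coe, ENNReal.coe_mul]
        exact h2
      exact NNReal.coe_le_coe.mpr h3)

theorem matrixOp_apply (a : κ → ι → ℂ) (ha : SchurBounded a) (f : EllTwo ι) (k : κ) :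
    matrixOp a ha f k = ∑' i, a k i * f i := rfl

theorem matrixOp_single [DecidableEq ι] (a : κ → ι → ℂ) (ha : SchurBounded a) (i : ι) (k : κ) :
    matrixOp a ha (lp.single 2 i 1) k = a k i := by
  rw [matrixOp_apply, tsum_eq_single i]
  · simp
  · intro j hj
    simp [hj]

end MatrixOp

/-! ### Weighted graphs -/

/-- A connected simple graph of bounded valency with positive weights on its oriented edges
(`SimpleGraph.Dart`) and finite total weight. -/
structure WeightedGraph (V : Type*) where
  /-- the underlying graph -/
  graph : SimpleGraph V
  connected : graph.Connected
  boundedValency : ∃ M : ℕ, ∀ x, (graph.neighborSet x).encard ≤ M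
  /-- the weight of an oriented edge -/
  weight : graph.Dart → ℝ
  weight_pos : ∀ e, 0 < weight e
  summable_weight : Summable weight

namespace WeightedGraph

section

open scoped Classical

variable {V : Type*} (X : WeightedGraph V)

/-- The set of oriented edges. -/
abbrev OE : Type _ := X.graph.Dart

/-- Matrix of `J e = w(e⁻¹) e⁻¹`. -/
noncomputable def flipMatrix (e' e : X.OE) : ℂ := if e' = e.symm then (X.weight e' : ℂ) else 0

/-- Matrix of `σ x = ∑_{o(e) = x} w(e) e`. -/
noncomputable def sigmaMatrix (e : X.OE) (x : V) : ℂ := if e.fst = x then (X.weight e : ℂ) else 0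

/-- Matrix of `τ e = ` terminal vertex of `e`. -/
noncomputable def tauMatrix (x : V) (e : X.OE) : ℂ := if e.snd = x then 1 else 0

/-- Matrix of `A x = ∑_{x' ∼ x} w(x, x') x'`. -/
noncomputable def adjMatrix (x' x : V) : ℂ :=
  if h : X.graph.Adj x x' then (X.weight ⟨(x, x'), h⟩ : ℂ) else 0

/-- Matrix of `B₂ x = ∑_{x' ∼ x} W(x, x') x`, where `W(x, x') = w(x, x') w(x', x)`. -/
noncomputable def returnMatrix (x' x : V) : ℂ :=
  if x' = x then ∑' e : {e : X.OE // e.fst = x}, (X.weight e.1 : ℂ) * X.weight e.1.symm else 0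

theorem tsum_enorm_lt_top : ∑' e, ‖(X.weight e : ℂ)‖ₑ < ⊤ := by
  have h : Summable fun e => ‖(X.weight e : ℂ)‖₊ := by
    refine NNReal.summable_coe.mp ?_
    simpa [abs_of_pos (X.weight_pos _)] using X.summable_weight
  exact (ENNReal.tsum_coe_ne_top_iff_summable.mpr h).lt_top

theorem schurBounded_of_le {κ ι : Type*} {a : κ → ι → ℂ} {D : ℝ≥0∞} (hD : D < ⊤)
    (hr : ∀ k, ∑' i, ‖a k i‖ₑ ≤ D) (hc : ∀ i, ∑' k, ‖a k i‖ₑ ≤ D) : SchurBounded a :=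
  ⟨D.toNNReal, by simpa [ENNReal.coe_toNNReal hD.ne] using hr,
    by simpa [ENNReal.coe_toNNReal hD.ne] using hc⟩

theorem flip_bounded : SchurBounded X.flipMatrix := by
  refine schurBounded_of_le X.tsum_enorm_lt_top (fun e' => ?_) (fun e => ?_)
  · rw [tsum_eq_single e'.symm]
    · simpa [flipMatrix] using ENNReal.le_tsum (f := fun e => ‖(X.weight e : ℂ)‖ₑ) e'
    · intro e he
      have : e' ≠ e.symm := fun h => he (by simp [h])
      simp [flipMatrix, this]
  · refine ENNReal.tsum_le_tsum fun e' => ?_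
    unfold flipMatrix
    split_ifs <;> simp

theorem sigma_bounded : SchurBounded X.sigmaMatrix := by
  refine schurBounded_of_le X.tsum_enorm_lt_top (fun e => ?_) (fun x => ?_)
  · rw [tsum_eq_single e.fst]
    · simpa [sigmaMatrix] using ENNReal.le_tsum (f := fun e => ‖(X.weight e : ℂ)‖ₑ) e
    · intro x hx
      simp [sigmaMatrix, hx.symm]
  · refine ENNReal.tsum_le_tsum fun e' => ?_
    unfold sigmaMatrix
    split_ifs <;> simp

theorem tau_bounded : SchurBounded X.tauMatrix := by
  obtain ⟨M, hM⟩ := X.boundedValency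
  refine schurBounded_of_le (D := ((M : ℝ≥0∞) + 1)) (by finiteness) (fun x => ?_) (fun e => ?_)
  · have h1 : ∑' e, ‖X.tauMatrix x e‖ₑ = ∑' _ : {e : X.OE | e.snd = x}, (1 : ℝ≥0∞) := by
      rw [tsum_subtype {e : X.OE | e.snd = x} (fun _ => (1 : ℝ≥0∞))]
      refine tsum_congr fun e => ?_
      by_cases h : e.snd = x <;> simp [tauMatrix, h]
    have h2 : {e : X.OE | e.snd = x}.encard ≤ M := by
      refine le_trans ?_ (hM x)
      refine Set.encard_le_encard_of_injOn (f := fun e : X.OE => e.fst) ?_ ?_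
      · intro e he
        obtain rfl : e.snd = x := he
        exact e.adj.symm
      · intro e he e' he' h
        obtain rfl : e.snd = x := he
        have he' : e'.snd = e.snd := he'
        exact SimpleGraph.Dart.ext _ _ (Prod.ext h he'.symm)
    rw [h1, ENNReal.tsum_set_one]
    have h3 : (({e : X.OE | e.snd = x}.encard : ℕ∞) : ℝ≥0∞) ≤ ((M : ℕ∞) : ℝ≥0∞) :=
      ENat.toENNReal_le.mpr h2
    exact h3.trans (by simp)
  · rw [tsum_eq_single e.snd]
    · simp [tauMatrix]
    · intro x hx
      simp [tauMatrix, hx.symm]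

theorem enorm_adjMatrix_le (x' x : V) : ‖X.adjMatrix x' x‖ₑ ≤
    ∑' e : X.OE, if e.fst = x ∧ e.snd = x' then ‖(X.weight e : ℂ)‖ₑ else 0 := by
  unfold adjMatrix
  split_ifs with h
  · refine le_trans ?_ (ENNReal.le_tsum (⟨(x, x'), h⟩ : X.OE))
    simp
  · simp

theorem adj_bounded : SchurBounded X.adjMatrix := by
  refine schurBounded_of_le X.tsum_enorm_lt_top (fun x' => ?_) (fun x => ?_)
  · refine (ENNReal.tsum_le_tsum fun x => X.enorm_adjMatrix_le x' x).trans ?_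
    rw [ENNReal.tsum_comm]
    refine ENNReal.tsum_le_tsum fun e => ?_
    rw [tsum_eq_single e.fst]
    · split_ifs <;> simp
    · intro x hx
      simp [hx.symm]
  · refine (ENNReal.tsum_le_tsum fun x' => X.enorm_adjMatrix_le x' x).trans ?_
    rw [ENNReal.tsum_comm]
    refine ENNReal.tsum_le_tsum fun e => ?_
    rw [tsum_eq_single e.snd]
    · split_ifs <;> simp
    · intro x hx
      simp [hx.symm]

theorem return_bounded : SchurBounded X.returnMatrix := by
  set D := ∑' e, ‖(X.weight e : ℂ)‖ₑ with hD
  have hlt : D < ⊤ := X.tsum_enorm_lt_top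
  have key : ∀ x, ‖X.returnMatrix x x‖ₑ ≤ D * D := fun x => by
    simp only [returnMatrix, if_true]
    refine enorm_tsum_le_tsum_enorm.trans ?_
    refine (ENNReal.tsum_comp_le_tsum_of_injective Subtype.val_injective
      (fun e : X.OE => ‖(X.weight e : ℂ) * X.weight e.symm‖ₑ)).trans ?_
    simp only [enorm_mul]
    rw [hD, ← ENNReal.tsum_mul_right]
    refine ENNReal.tsum_le_tsum fun e => ?_
    gcongr
    exact ENNReal.le_tsum (f := fun e => ‖(X.weight e : ℂ)‖ₑ) e.symm
  refine schurBounded_of_le (D := D * D) (ENNReal.mul_lt_top hlt hlt) (fun x' => ?_) (fun x => ?_)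
  · rw [tsum_eq_single x']
    · exact key x'
    · intro x hx
      simp [returnMatrix, hx.symm]
  · rw [tsum_eq_single x]
    · exact key x
    · intro x' hx
      simp [returnMatrix, hx]

/-- `C₀ = ℓ²(VX)`. (The vertex set is the type `V`.) -/
abbrev C₀ (_X : WeightedGraph V) : Type _ := EllTwo V

/-- `C₁ = ℓ²(OE)`. -/
abbrev C₁ : Type _ := EllTwo X.OE

/-- The weighted flip, `J e = w(e⁻¹) e⁻¹`. -/
noncomputable def J : X.C₁ →L[ℂ] X.C₁ := matrixOp X.flipMatrix X.flip_bounded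

/-- `σ x = ∑_{o(e) = x} w(e) e`. -/
noncomputable def σ : X.C₀ →L[ℂ] X.C₁ := matrixOp X.sigmaMatrix X.sigma_bounded

/-- `τ` maps an oriented edge to its terminal vertex. -/
noncomputable def τ : X.C₁ →L[ℂ] X.C₀ := matrixOp X.tauMatrix X.tau_bounded

/-- The adjacency operator, `A x = ∑_{x' ∼ x} w(x, x') x'`. -/
noncomputable def A : X.C₀ →L[ℂ] X.C₀ := matrixOp X.adjMatrix X.adj_bounded

/-- `B₂ x = ∑_{x' ∼ x} W(x, x') x`, where `W(x, x') = w(x, x') w(x', x)`. -/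
noncomputable def B₂ : X.C₀ →L[ℂ] X.C₀ := matrixOp X.returnMatrix X.return_bounded

/-- The Hilbert space direct sum `C₀ ⊕ C₁`. -/
abbrev C₀₁ : Type _ := WithLp 2 (X.C₀ × X.C₁)

/-- The operator on `C₀ ⊕ C₁` given by the block matrix with rows `(a, b)` and `(c, d)`. -/
noncomputable def block (a : X.C₀ →L[ℂ] X.C₀) (b : X.C₁ →L[ℂ] X.C₀) (c : X.C₀ →L[ℂ] X.C₁)
    (d : X.C₁ →L[ℂ] X.C₁) : X.C₀₁ →L[ℂ] X.C₀₁ :=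
  (WithLp.prodContinuousLinearEquiv 2 ℂ X.C₀ X.C₁).symm.toContinuousLinearMap ∘L
    ((a.coprod b).prod (c.coprod d)) ∘L
      (WithLp.prodContinuousLinearEquiv 2 ℂ X.C₀ X.C₁).toContinuousLinearMap

/-- A cycle is a closed path `e₁, …, eₙ` of positive length, up to cyclic shifts, without
backtracking and without tail; it is written as the cyclic sequence of its oriented edges. -/
def IsCycle (c : Cycle X.OE) : Prop :=
  c ≠ Cycle.nil ∧ c.Chain fun e e' => e.snd = e'.fst ∧ e' ≠ e.symm

/-- A prime cycle is a cycle that is not a proper power of a closed path. -/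
def IsPrimeCycle (c : Cycle X.OE) : Prop :=
  X.IsCycle c ∧ ¬ ∃ (l : List X.OE) (j : ℕ), 2 ≤ j ∧ c = ((List.replicate j l).flatten : List X.OE)

/-- The weight `w(p)` of a cycle, the product of the weights of its oriented edges. -/
noncomputable def cycleWeight (c : Cycle X.OE) : ℝ := (c.toMultiset.map X.weight).prod

/-- The Euler product `Z(u) = ∏ₚ (1 - w(p) u^{l(p)})⁻¹` over all prime cycles converges
(unconditionally) and has the value `z`. -/
def HasZeta (u z : ℂ) : Prop :=
  HasProd (fun p : {c : Cycle X.OE // X.IsPrimeCycle c} =>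
    (1 - (X.cycleWeight p.1 : ℂ) * u ^ p.1.length)⁻¹) z

/-- `F` is the function `Z(u)⁻¹` on `ℂ`: for small `|u|` the Euler product converges to a nonzero
number with inverse `F u`, and `F` is entire (hence uniquely determined). -/
def IsZetaReciprocal (F : ℂ → ℂ) : Prop :=
  Differentiable ℂ F ∧ ∃ r > 0, ∀ u : ℂ, ‖u‖ < r → ∃ z, X.HasZeta u z ∧ z ≠ 0 ∧ F u = z⁻¹

end

end WeightedGraph

/-! Both sides of the formula equal `det (1 - u T)`, where `T = σ τ - J` is the edge transfer
operator: its entry from `e` to `e'` is `w(e')` if `e'` may follow `e` without backtracking, and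
zero otherwise.

Zeta side. Every nonempty word in the oriented edges is a power of exactly one primitive word, and a
primitive word of length `n` has `n` distinct rotations. Hence the sum of `-log (1 - w(p) u^l(p))`
over prime cycles is the sum over all closed non-backtracking edge words of weight divided by length
(`hasSum_neg_log_primitiveCycle`), that is, `∑ tr (uT)^m / m`. For small `u` this is `-log det (1 -
u T)` (`fredholmDet_neg_eq_exp`), and the determinant is entire in `u`.

Block side. Since `τ σ = A` and `τ J σ = B₂`, the block operator plus the identity is a product of
two unipotent factors and a block triangular one with diagonal `1`, `1 - u T`
(`Matrix.det_one_add_bassBlocks`).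

Both identities are finite-dimensional algebra. They pass to infinite matrices because a Fredholm
determinant is the sum of all principal minors, and these are dominated by products of row sums
(`tendsto_fredholmDet`). Finally `hasFredholmDet_of_summable_entries` identifies the sum of minors
with `∑ tr ⋀ᵏ`, whatever orthonormal basis is used for the traces. -/

/-! ### Fredholm determinants of infinite matrices -/

section TupleSums

/-- A finite product of absolutely convergent series is the absolutely convergent sum over tuples. -/
theorem summable_norm_hasSum_prod_tuple {R N : Type*} [NormedCommRing R] [NormOneClass R]
    [CompleteSpace R] :
    ∀ {k : ℕ} (f : Fin k → N → R), (∀ i, Summable fun n => ‖f i n‖) →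
      Summable (fun n : Fin k → N => ‖∏ i, f i (n i)‖) ∧
      HasSum (fun n : Fin k → N => ∏ i, f i (n i)) (∏ i, ∑' n, f i n)
  | 0, f, _ => by
    simp only [Finset.univ_eq_empty, Finset.prod_empty]
    exact ⟨(hasSum_fintype _).summable, by simp⟩
  | k + 1, f, hf => by
    obtain ⟨h1, h2⟩ := summable_norm_hasSum_prod_tuple (fun i : Fin k => f i.succ)
      (fun i => hf i.succ)
    have h3 := (hf 0).mul_norm h1
    have e : ∀ p : N × (Fin k → N), f 0 p.1 * ∏ i, f i.succ (p.2 i) =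
        ∏ i, f i ((Fin.consEquiv fun _ : Fin (k + 1) => N) p i) := fun p => by
      rw [Fin.prod_univ_succ]; rfl
    have h4 := (hf 0).of_norm.hasSum.mul h2 h3.of_norm
    simp only [e] at h3 h4
    rw [Fin.prod_univ_succ]
    exact ⟨(Fin.consEquiv fun _ : Fin (k + 1) => N).summable_iff.mp h3,
      (Fin.consEquiv fun _ : Fin (k + 1) => N).hasSum_iff.mp h4⟩

end TupleSums

/-! ### Principal minors: domination, continuity, finite reduction, dependence on a parameter. -/

section InfiniteMatrix

variable {I : Type*}

open Classical in
/-- The principal minor of an infinite matrix on a finite set of indices. -/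
noncomputable def principalMinor (a : I → I → ℂ) (s : Finset I) : ℂ :=
  (Matrix.of fun i j : s => a i j).det

/-- The Fredholm determinant `det (1 + a)` as the sum of all principal minors. -/
noncomputable def fredholmDet (a : I → I → ℂ) : ℂ := ∑' s : Finset I, principalMinor a s

/-- In the Leibniz expansion, enlarging the sum from permutations of `s` to all maps `s → s` only
adds nonnegative terms, and the larger sum factors into row sums. -/
theorem norm_principalMinor_le {a : I → I → ℂ} {R : I → I → ℝ} (hR : ∀ i, Summable (R i))
    (ha : ∀ i j, ‖a i j‖ ≤ R i j) (s : Finset I) :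
    ‖principalMinor a s‖ ≤ ∏ i ∈ s, ∑' j, R i j := by
  classical
  have hR0 : ∀ i j, 0 ≤ R i j := fun i j => (norm_nonneg _).trans (ha i j)
  have h1 : ‖principalMinor a s‖ ≤ ∑ σ : Equiv.Perm s, ∏ i : s, R i (σ i) := by
    unfold principalMinor
    rw [← Matrix.det_transpose, Matrix.det_apply']
    refine (norm_sum_le _ _).trans (Finset.sum_le_sum fun σ _ => ?_)
    rw [norm_mul, norm_prod]
    have : ‖((Equiv.Perm.sign σ : ℤ) : ℂ)‖ = 1 := by
      rcases Int.units_eq_one_or (Equiv.Perm.sign σ) with h | h <;> simp [h]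
    rw [this, one_mul]
    exact Finset.prod_le_prod (fun _ _ => norm_nonneg _) fun i _ => ha _ _
  refine h1.trans ?_
  calc ∑ σ : Equiv.Perm s, ∏ i : s, R i (σ i)
      = ∑ f ∈ Finset.univ.image (fun σ : Equiv.Perm s => (σ : s → s)), ∏ i : s, R i (f i) := by
        rw [Finset.sum_image]
        intro σ _ τ _ h
        exact DFunLike.coe_injective h
    _ ≤ ∑ f : s → s, ∏ i : s, R i (f i) :=
        Finset.sum_le_sum_of_subset_of_nonneg (Finset.subset_univ _)
          fun _ _ _ => Finset.prod_nonneg fun _ _ => hR0 _ _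
    _ = ∏ i : s, ∑ j : s, R i j := by
        rw [Finset.prod_univ_sum, Fintype.piFinset_univ]
    _ ≤ ∏ i : s, ∑' j, R i j := by
        refine Finset.prod_le_prod (fun _ _ => Finset.sum_nonneg fun _ _ => hR0 _ _) fun i _ => ?_
        rw [Finset.sum_coe_sort s (fun j => R i j)]
        exact (hR i).sum_le_tsum _ fun _ _ => hR0 _ _
    _ = _ := Finset.prod_coe_sort s (fun i => ∑' j, R i j)

variable {R : I → I → ℝ}

/-- This is the expansion of `∏ (1 + rᵢ)` with `rᵢ` the row sums, which converges because `∑ rᵢ`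
does. It is the dominating series for all determinants below. -/
theorem summable_prod_rowSum (hR0 : ∀ i j, 0 ≤ R i j)
    (hR : Summable fun p : I × I => R p.1 p.2) :
    Summable fun s : Finset I => ∏ i ∈ s, ∑' j, R i j :=
  summable_finsetProd_of_summable_nonneg (fun i => tsum_nonneg (hR0 i)) hR.prod

theorem summable_norm_principalMinor {a : I → I → ℂ} (hR : Summable fun p : I × I => R p.1 p.2)
    (ha : ∀ i j, ‖a i j‖ ≤ R i j) : Summable fun s => ‖principalMinor a s‖ :=
  .of_nonneg_of_le (fun _ => norm_nonneg _) (norm_principalMinor_le hR.prod_factor ha)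
    (summable_prod_rowSum (fun i j => (norm_nonneg _).trans (ha i j)) hR)

theorem tendsto_principalMinor {β : Type*} {l : Filter β} {a : β → I → I → ℂ} {a₀ : I → I → ℂ}
    (h : ∀ i j, Filter.Tendsto (fun n => a n i j) l (nhds (a₀ i j))) (s : Finset I) :
    Filter.Tendsto (fun n => principalMinor (a n) s) l (nhds (principalMinor a₀ s)) := by
  classical
  unfold principalMinor
  have hc : Continuous fun M : Matrix s s ℂ => M.det := continuous_id.matrix_det
  refine (hc.tendsto _).comp ?_
  refine tendsto_pi_nhds.mpr fun i => tendsto_pi_nhds.mpr fun j => ?_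
  exact h i j

/-- Dominated convergence for Fredholm determinants. -/
theorem tendsto_fredholmDet {β : Type*} {l : Filter β} {a : β → I → I → ℂ} {a₀ : I → I → ℂ}
    (hR : Summable fun p : I × I => R p.1 p.2) (ha : ∀ n i j, ‖a n i j‖ ≤ R i j)
    (h : ∀ i j, Filter.Tendsto (fun n => a n i j) l (nhds (a₀ i j))) :
    Filter.Tendsto (fun n => fredholmDet (a n)) l (nhds (fredholmDet a₀)) := by
  rcases l.eq_or_neBot with rfl | hl
  · exact Filter.tendsto_bot
  obtain ⟨n⟩ : Nonempty β := hl.nonempty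
  exact tendsto_tsum_of_dominated_convergence
    (summable_prod_rowSum (fun i j => (norm_nonneg _).trans (ha n i j)) hR)
    (tendsto_principalMinor h)
    (.of_forall fun n s => norm_principalMinor_le hR.prod_factor (ha n) s)

theorem principalMinor_eq_zero {a : I → I → ℂ} {s : Finset I} {i : I} (hi : i ∈ s)
    (h : ∀ j, a i j = 0) : principalMinor a s = 0 :=
  by classical exact Matrix.det_eq_zero_of_row_eq_zero ⟨i, hi⟩ fun j => h j

theorem principalMinor_eq_det {κ : Type*} [Fintype κ] [DecidableEq κ] (a : I → I → ℂ)
    {s : Finset I} (e : κ ≃ s) :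
    principalMinor a s = (Matrix.of fun i j => a (e i) (e j)).det := by
  classical
  unfold principalMinor
  rw [← Matrix.det_submatrix_equiv_self e]
  rfl

theorem Matrix.det_one_add_eq_sum_det_submatrix {n R : Type*} [Fintype n] [DecidableEq n]
    [CommRing R] (M : Matrix n n R) :
    (1 + M).det = ∑ s : Finset n, (M.submatrix (Subtype.val : s → n) Subtype.val).det := by
  rw [add_comm]
  change (Matrix.detRowAlternating : (n → R) [⋀^n]→ₗ[R] R) (M.row + (1 : Matrix n n R).row) = _
  rw [AlternatingMap.map_add_univ]
  exact Finset.sum_congr rfl fun s _ => Matrix.det_piecewise_one_eq_submatrix_det M s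

/-- An infinite matrix with finitely many nonzero rows has the determinant of a finite block. -/
theorem fredholmDet_eq_det {κ : Type*} [Fintype κ] [DecidableEq κ] (a : I → I → ℂ) (φ : κ ↪ I)
    (h : ∀ i ∉ Set.range φ, ∀ j, a i j = 0) :
    fredholmDet a = (1 + Matrix.of fun i j => a (φ i) (φ j)).det := by
  classical
  rw [Matrix.det_one_add_eq_sum_det_submatrix, fredholmDet, ← tsum_fintype (L := .unconditional _)]
  -- An index set that leaves the range of `φ` picks up a zero row, so only images of subsets of `κ`
  -- contribute.
  have hs : Function.support (principalMinor a) ⊆ Set.range (Finset.map φ) := by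
    intro s hs
    by_contra hr
    have : ¬ ((s : Set I) ⊆ Set.range φ) := by
      intro hsub
      refine hr ⟨s.preimage φ φ.injective.injOn, ?_⟩
      rw [Finset.map_eq_image, Finset.image_preimage, Finset.filter_true_of_mem]
      exact fun x hx => hsub hx
    obtain ⟨i, hi, hi'⟩ := Set.not_subset.mp this
    exact hs (principalMinor_eq_zero hi (h i hi'))
  rw [← (Finset.map_injective φ).tsum_eq hs]
  refine tsum_congr fun t => ?_
  refine principalMinor_eq_det a (Equiv.ofBijective
    (fun i : t => (⟨φ i, Finset.mem_map_of_mem φ i.2⟩ : t.map φ)) ⟨fun i j h => ?_, fun j => ?_⟩)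
  · exact Subtype.ext (φ.injective (congrArg Subtype.val h))
  · obtain ⟨i, hi, h⟩ := Finset.mem_map.mp j.2
    exact ⟨⟨i, hi⟩, Subtype.ext h⟩

theorem principalMinor_smul (c : ℂ) (a : I → I → ℂ) (s : Finset I) :
    principalMinor (c • a) s = c ^ s.card * principalMinor a s := by
  classical
  unfold principalMinor
  rw [show (Matrix.of fun i j : s => (c • a) i j) = c • Matrix.of fun i j : s => a i j from rfl,
    Matrix.det_smul, Fintype.card_coe]

/-- The Fredholm determinant `det (1 + u a)` is an entire function of `u`. -/
theorem differentiable_fredholmDet_smul {a : I → I → ℂ} (hR : Summable fun p : I × I => ‖a p.1 p.2‖) :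
    Differentiable ℂ fun u : ℂ => fredholmDet (u • a) := by
  have key : ∀ r : ℝ, 0 < r → DifferentiableOn ℂ (fun u : ℂ => fredholmDet (u • a))
      (Metric.ball 0 r) := fun r hr => by
    -- The minor of `u • a` on `s` is homogeneous of degree `s.card` in `u`, so on the ball every
    -- term is dominated by its value at `u = r`.
    have hsum := summable_norm_principalMinor (a := (r : ℂ) • a)
      (R := fun i j => ‖((r : ℂ) • a) i j‖) (by
        simpa [Pi.smul_apply, norm_mul] using hR.mul_left ‖(r : ℂ)‖) (fun _ _ => le_rfl)
    refine Complex.differentiableOn_tsum_of_summable_norm hsum (fun s => ?_) Metric.isOpen_ball ?_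
    · simp only [principalMinor_smul]
      fun_prop
    · intro s u hu
      rw [principalMinor_smul, principalMinor_smul, norm_mul, norm_mul, norm_pow, norm_pow]
      have : ‖u‖ ≤ ‖(r : ℂ)‖ := by
        rw [Complex.norm_real, Real.norm_of_nonneg hr.le]
        exact (mem_ball_zero_iff.mp hu).le
      gcongr
  intro u
  have hu : u ∈ Metric.ball (0 : ℂ) (‖u‖ + 1) := by simp
  exact (key (‖u‖ + 1) (by positivity)).differentiableAt (Metric.isOpen_ball.mem_nhds hu)

end InfiniteMatrix

/-! ### Exterior traces of nuclear operators -/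

/-! ### From sums over tuples to sums over subsets. -/

section TupleSubset

variable {P : Type*}

/-- A convergent sum over `k`-tuples of a symmetric function vanishing on non-injective tuples
is `k!` times the sum over `k`-element subsets. -/
theorem hasSum_subset_of_hasSum_tuple {k : ℕ} {D : (Fin k → P) → ℂ} {a : ℂ}
    (hsymm : ∀ p (σ : Equiv.Perm (Fin k)), D (p ∘ σ) = D p)
    (hinj : ∀ p, ¬ Function.Injective p → D p = 0) (h : HasSum D a) :
    HasSum (fun s : {s : Finset P // s.card = k} =>
      D fun i => (s.1.equivFinOfCardEq s.2).symm i) (a / k.factorial) := by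
  classical
  -- A subset together with a permutation of its chosen enumeration is the same as an injective
  -- tuple; by symmetry each subset accounts for `k!` equal terms.
  let F : (Σ _ : {s : Finset P // s.card = k}, Equiv.Perm (Fin k)) → Fin k → P :=
    fun q i => (q.1.1.equivFinOfCardEq q.1.2).symm (q.2 i)
  have himg : ∀ q, Finset.univ.image (F q) = q.1.1 := fun q => by
    ext x
    simp only [Finset.mem_image, Finset.mem_univ, true_and, F]
    constructor
    · rintro ⟨i, rfl⟩
      exact ((q.1.1.equivFinOfCardEq q.1.2).symm (q.2 i)).2
    · intro hx
      exact ⟨q.2.symm (q.1.1.equivFinOfCardEq q.1.2 ⟨x, hx⟩), by simp⟩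
  have hF : Function.Injective F := by
    rintro ⟨s, σ⟩ ⟨t, τ⟩ h
    obtain rfl : s = t := Subtype.ext (by rw [← himg ⟨s, σ⟩, ← himg ⟨t, τ⟩, h])
    congr 1
    ext i
    have := congrFun h i
    simpa [F, Fin.ext_iff] using this
  have hz : ∀ p ∉ Set.range F, D p = 0 := by
    intro p hp
    refine hinj p fun hpi => hp ?_
    let s : {s : Finset P // s.card = k} := ⟨Finset.univ.image p, by
      rw [Finset.card_image_of_injective _ hpi]; simp⟩
    let f : Fin k → Fin k := fun i =>
      s.1.equivFinOfCardEq s.2 ⟨p i, Finset.mem_image_of_mem p (Finset.mem_univ i)⟩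
    have hf : Function.Injective f := fun i j hij => hpi (by simpa [f] using hij)
    refine ⟨⟨s, Equiv.ofBijective f (Finite.injective_iff_bijective.mp hf)⟩, ?_⟩
    funext i
    simp [F, f]
  have h1 := ((hF.hasSum_iff hz).mpr h).sigma fun s => hasSum_fintype _
  have h2 := h1.mul_left ((k.factorial : ℂ)⁻¹)
  rw [div_eq_inv_mul]
  refine h2.congr_fun fun s => ?_
  have h3 : ∀ σ : Equiv.Perm (Fin k), D (F ⟨s, σ⟩) =
      D fun i => (s.1.equivFinOfCardEq s.2).symm i := fun σ => by
    exact hsymm (fun i => (s.1.equivFinOfCardEq s.2).symm i) σ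
  simp only [Function.comp, h3]
  rw [Finset.sum_const, Finset.card_univ, Fintype.card_perm, Fintype.card_fin, nsmul_eq_mul,
    inv_mul_cancel_left₀ (by exact_mod_cast k.factorial_ne_zero)]

end TupleSubset

/-! ### Nuclear representations and independence of the orthonormal basis. -/

section Nuclear

variable {H : Type*} [NormedAddCommGroup H] [InnerProductSpace ℂ H]

/-- Summability leaves only countably many nonzero terms; encoding their indices in `ℕ` and
extending by zero gives a representation indexed as `IsTraceClass` demands. -/
theorem isTraceClass_of_hasSum {N : Type*} {x y : N → H} (hs : Summable fun n => ‖x n‖ * ‖y n‖)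
    {T : H →L[ℂ] H} (hT : ∀ v, HasSum (fun n => ⟪x n, v⟫_ℂ • y n) (T v)) : IsTraceClass T := by
  classical
  set S := Function.support fun n => ‖x n‖ * ‖y n‖ with hS
  have : Countable S := hs.countable_support
  have := Encodable.ofCountable S
  have hinj : Function.Injective (Encodable.encode (α := S)) := Encodable.encode_injective
  refine ⟨Function.extend (Encodable.encode (α := S)) (fun n => x n) 0,
    Function.extend (Encodable.encode (α := S)) (fun n => y n) 0, ?_, fun v => ?_⟩
  · refine (hinj.summable_iff fun m hm => ?_).mp ?_
    · rw [Function.extend_apply' _ _ _ hm]; simp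
    · simp only [Function.comp_def, hinj.extend_apply]
      exact hs.subtype S
  · refine (hinj.hasSum_iff fun m hm => ?_).mp ?_
    · rw [Function.extend_apply' _ _ _ hm]; simp
    · simp only [Function.comp_def, hinj.extend_apply]
      refine (hasSum_subtype_iff_of_support_subset (f := fun n => ⟪x n, v⟫_ℂ • y n) ?_).mpr (hT v)
      intro n hn hn0
      apply hn
      rcases mul_eq_zero.mp hn0 with h | h <;> simp [norm_eq_zero.mp h]

variable {P : Type*} (b : HilbertBasis P ℂ H)

/-- Cauchy–Schwarz on finite sums, followed by Bessel's inequality for each factor. -/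
theorem HilbertBasis.summable_norm_inner_mul_norm_inner (x y : H) :
    (Summable fun p => ‖⟪x, b p⟫_ℂ‖ * ‖⟪b p, y⟫_ℂ‖) ∧
      ∑' p, ‖⟪x, b p⟫_ℂ‖ * ‖⟪b p, y⟫_ℂ‖ ≤ ‖x‖ * ‖y‖ := by
  have h : ∀ s : Finset P, ∑ p ∈ s, ‖⟪x, b p⟫_ℂ‖ * ‖⟪b p, y⟫_ℂ‖ ≤ ‖x‖ * ‖y‖ := fun s => by
    refine (Real.sum_mul_le_sqrt_mul_sqrt _ _ _).trans ?_
    gcongr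
    · refine Real.sqrt_le_iff.mpr ⟨norm_nonneg _, ?_⟩
      simpa only [norm_inner_symm x] using b.orthonormal.sum_inner_products_le x (s := s)
    · exact Real.sqrt_le_iff.mpr ⟨norm_nonneg _, b.orthonormal.sum_inner_products_le y⟩
  have h0 : ∀ p, 0 ≤ ‖⟪x, b p⟫_ℂ‖ * ‖⟪b p, y⟫_ℂ‖ := fun p => by positivity
  exact ⟨summable_of_sum_le h0 h, Real.tsum_le_of_sum_le h0 h⟩

variable {N : Type*} {x y : N → H}

/-- This licenses the exchange of the sums over `n` and `p`. Moving the `x`-factors by `σ` makes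
each `p i` occur in one factor only; summing over it costs at most `‖x‖ ‖y‖`, and the permuted norms
regroup to `∏ ‖x (n i)‖ ‖y (n i)‖`. -/
theorem HilbertBasis.summable_nuclear_tuple (hs : Summable fun n => ‖x n‖ * ‖y n‖) {k : ℕ}
    (σ : Equiv.Perm (Fin k)) :
    Summable fun q : (Fin k → N) × (Fin k → P) =>
      ∏ i, (⟪b (q.2 i), y (q.1 i)⟫_ℂ * ⟪x (q.1 i), b (q.2 (σ i))⟫_ℂ) := by
  have hf : ∀ n : Fin k → N, ∀ i, Summable fun p =>
      ‖‖⟪x (n (σ.symm i)), b p⟫_ℂ‖ * ‖⟪b p, y (n i)⟫_ℂ‖‖ := fun n i => by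
    simpa using (b.summable_norm_inner_mul_norm_inner (x (n (σ.symm i))) (y (n i))).1
  have hre : ∀ q : (Fin k → N) × (Fin k → P),
      ‖∏ i, (⟪b (q.2 i), y (q.1 i)⟫_ℂ * ⟪x (q.1 i), b (q.2 (σ i))⟫_ℂ)‖ =
      ∏ i, (‖⟪x (q.1 (σ.symm i)), b (q.2 i)⟫_ℂ‖ * ‖⟪b (q.2 i), y (q.1 i)⟫_ℂ‖) := fun q => by
    simp only [norm_prod, norm_mul, Finset.prod_mul_distrib]
    rw [mul_comm]
    congr 1
    rw [← Equiv.prod_comp σ (fun i => ‖⟪x (q.1 (σ.symm i)), b (q.2 i)⟫_ℂ‖)]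
    simp
  refine Summable.of_norm ?_
  simp only [hre]
  refine (summable_prod_of_nonneg fun q => by positivity).mpr ⟨fun n => ?_, ?_⟩
  · exact (summable_norm_hasSum_prod_tuple _ (hf n)).1.of_norm
  · have hxy : ∀ i : Fin k, Summable fun n => ‖‖x n‖ * ‖y n‖‖ := fun _ => by simpa using hs
    refine Summable.of_nonneg_of_le (fun n => tsum_nonneg fun p => by positivity) (fun n => ?_)
      (summable_norm_hasSum_prod_tuple _ hxy).1.of_norm
    rw [(summable_norm_hasSum_prod_tuple _ (hf n)).2.tsum_eq]
    calc ∏ i, ∑' p, ‖⟪x (n (σ.symm i)), b p⟫_ℂ‖ * ‖⟪b p, y (n i)⟫_ℂ‖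
        ≤ ∏ i, ‖x (n (σ.symm i))‖ * ‖y (n i)‖ :=
          Finset.prod_le_prod (fun i _ => tsum_nonneg fun p => by positivity) fun i _ =>
            (b.summable_norm_inner_mul_norm_inner _ _).2
      _ = ∏ i, (‖x (n i)‖ * ‖y (n i)‖) := by
          rw [Finset.prod_mul_distrib, Finset.prod_mul_distrib,
            Equiv.prod_comp σ.symm (fun i => ‖x (n i)‖)]

/-- For a nuclear operator, the sums over `k`-tuples of the principal `k × k` determinants in an
orthonormal basis and of the mixed Gram determinants of a nuclear representation agree. -/
theorem HilbertBasis.exists_hasSum_det_nuclear (hs : Summable fun n => ‖x n‖ * ‖y n‖)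
    {T : H →L[ℂ] H} (hT : ∀ v, HasSum (fun n => ⟪x n, v⟫_ℂ • y n) (T v)) (k : ℕ) :
    ∃ A, HasSum (fun p : Fin k → P => (Matrix.of fun i j => ⟪b (p i), T (b (p j))⟫_ℂ).det) A ∧
      HasSum (fun n : Fin k → N => (Matrix.of fun i j => ⟪x (n i), y (n j)⟫_ℂ).det) A := by
  let A : Equiv.Perm (Fin k) → ℂ := fun σ => ∑' q : (Fin k → N) × (Fin k → P),
      ∏ i, (⟪b (q.2 i), y (q.1 i)⟫_ℂ * ⟪x (q.1 i), b (q.2 (σ i))⟫_ℂ)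
  have hA := fun σ : Equiv.Perm (Fin k) => (b.summable_nuclear_tuple hs σ).hasSum
  have hdet : ∀ M : Matrix (Fin k) (Fin k) ℂ, M.det =
      ∑ σ : Equiv.Perm (Fin k), ((Equiv.Perm.sign σ : ℤ) : ℂ) * ∏ i, M i (σ i) := fun M => by
    rw [← Matrix.det_transpose, Matrix.det_apply']
    rfl
  refine ⟨∑ σ : Equiv.Perm (Fin k), ((Equiv.Perm.sign σ : ℤ) : ℂ) * A σ, ?_, ?_⟩
  · simp only [hdet]
    refine hasSum_sum fun σ _ => HasSum.mul_left _ ?_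
    -- With `p` fixed, summing over `n` rebuilds the matrix entries of `T` in the basis.
    refine ((Equiv.prodComm _ _).hasSum_iff.mpr (hA σ)).prod_fiberwise fun p => ?_
    have h1 : ∀ q q' : P, HasSum (fun n => ⟪b q, y n⟫_ℂ * ⟪x n, b q'⟫_ℂ) ⟪b q, T (b q')⟫_ℂ :=
      fun q q' => by
        have := (hT (b q')).mapL (innerSL ℂ (b q))
        simpa [inner_smul_right, mul_comm] using this
    have h2 : ∀ i : Fin k, Summable fun n => ‖⟪b (p i), y n⟫_ℂ * ⟪x n, b (p (σ i))⟫_ℂ‖ := fun i => by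
      refine Summable.of_nonneg_of_le (fun n => norm_nonneg _) (fun n => ?_) hs
      rw [norm_mul, mul_comm]
      have e1 := norm_inner_le_norm (𝕜 := ℂ) (x n) (b (p (σ i)))
      have e2 := norm_inner_le_norm (𝕜 := ℂ) (b (p i)) (y n)
      rw [b.orthonormal.1, mul_one] at e1
      rw [b.orthonormal.1, one_mul] at e2
      gcongr
    have h3 := (summable_norm_hasSum_prod_tuple _ h2).2
    simp only [(h1 _ _).tsum_eq] at h3
    exact h3
  · simp only [hdet]
    refine hasSum_sum fun σ _ => HasSum.mul_left _ ?_
    -- With `n` fixed, summing over `p` is Parseval's identity and eliminates the basis.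
    refine (hA σ).prod_fiberwise fun n => ?_
    have h2 : ∀ i : Fin k, Summable fun p => ‖⟪x (n (σ.symm i)), b p⟫_ℂ * ⟪b p, y (n i)⟫_ℂ‖ :=
      fun i => by
        simpa only [norm_mul] using
          (b.summable_norm_inner_mul_norm_inner (x (n (σ.symm i))) (y (n i))).1
    have h3 := (summable_norm_hasSum_prod_tuple _ h2).2
    simp only [b.tsum_inner_mul_inner] at h3
    have e1 : ∏ i, ⟪x (n (σ.symm i)), y (n i)⟫_ℂ = ∏ i, ⟪x (n i), y (n (σ i))⟫_ℂ := by
      rw [← Equiv.prod_comp σ (fun i => ⟪x (n (σ.symm i)), y (n i)⟫_ℂ)]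
      simp
    rw [e1] at h3
    refine h3.congr_fun fun p => ?_
    simp only [Finset.prod_mul_distrib]
    rw [mul_comm]
    congr 1
    rw [← Equiv.prod_comp σ (fun i => ⟪x (n (σ.symm i)), b (p i)⟫_ℂ)]
    simp

theorem det_of_tuple_eq_zero {P : Type*} (M : P → P → ℂ) {k : ℕ} (p : Fin k → P)
    (hp : ¬ Function.Injective p) : (Matrix.of fun i j => M (p i) (p j)).det = 0 := by
  simp only [Function.Injective, not_forall] at hp
  obtain ⟨i, j, h, hij⟩ := hp
  exact Matrix.det_zero_of_row_eq hij (by funext l; simp [h])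

theorem det_of_tuple_comp_perm {P : Type*} (M : P → P → ℂ) {k : ℕ} (p : Fin k → P)
    (σ : Equiv.Perm (Fin k)) : (Matrix.of fun i j => M ((p ∘ σ) i) ((p ∘ σ) j)).det =
      (Matrix.of fun i j => M (p i) (p j)).det :=
  Matrix.det_submatrix_equiv_self σ (Matrix.of fun i j => M (p i) (p j))

/-- The Fredholm determinant of an operator whose matrix in a Parseval system of vectors is
absolutely summable is the sum of all principal minors of that matrix. -/
theorem hasFredholmDet_of_summable_entries [CompleteSpace H] {I : Type*} {e : I → H} (he : ∀ i, ‖e i‖ ≤ 1)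
    (hb : ∀ v, HasSum (fun i => ⟪e i, v⟫_ℂ • e i) v) (T : H →L[ℂ] H) (a : I → I → ℂ)
    (ha : ∀ i j, ⟪e i, T (e j)⟫_ℂ = a i j) (hs : Summable fun p : I × I => ‖a p.1 p.2‖) :
    HasFredholmDet T (fredholmDet a) := by
  -- Expanding `T v` by `hb` gives `T v = ∑ ⟪T† eᵢ, v⟫ eᵢ`, a nuclear representation; `‖T† eᵢ‖` is
  -- at most the `i`-th absolute row sum of `a`.
  set x : I → H := fun i => T.adjoint (e i) with hx
  have hxe : ∀ i v, ⟪x i, v⟫_ℂ = ⟪e i, T v⟫_ℂ := fun i v => T.adjoint_inner_left v (e i)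
  have hxn : ∀ i, ‖x i‖ ≤ ∑' j, ‖a i j‖ := fun i => by
    have h1 : ∀ j, ‖⟪e j, x i⟫_ℂ • e j‖ ≤ ‖a i j‖ := fun j => by
      rw [norm_smul, norm_inner_symm, hxe, ha]
      exact mul_le_of_le_one_right (norm_nonneg _) (he j)
    rw [← (hb (x i)).tsum_eq]
    exact tsum_of_norm_bounded (hs.prod_factor i).hasSum h1
  have hsum : Summable fun i => ‖x i‖ * ‖e i‖ := by
    refine Summable.of_nonneg_of_le (fun i => by positivity) (fun i => ?_) hs.prod
    exact (mul_le_of_le_one_right (norm_nonneg _) (he i)).trans (hxn i)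
  have hT : ∀ v, HasSum (fun i => ⟪x i, v⟫_ℂ • e i) (T v) := fun v => by
    simpa only [hxe] using hb (T v)
  have hminor := (summable_norm_principalMinor (a := a) (R := fun i j => ‖a i j‖) hs
    fun _ _ => le_rfl).of_norm
  refine ⟨isTraceClass_of_hasSum hsum hT,
    fun k => ∑' s : {s : Finset I // s.card = k}, principalMinor a s, fun k ι b => ?_, ?_⟩
  -- The mixed Gram determinants of `x` and `e` are the minors of `a` and do not involve `b`, so the
  -- exterior trace has the same value in every basis.
  · obtain ⟨A, hA1, hA2⟩ := b.exists_hasSum_det_nuclear hsum hT k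
    have h1 := hasSum_subset_of_hasSum_tuple
      (det_of_tuple_comp_perm fun p q => ⟪b p, T (b q)⟫_ℂ)
      (det_of_tuple_eq_zero fun p q => ⟪b p, T (b q)⟫_ℂ) hA1
    have h2 := hasSum_subset_of_hasSum_tuple
      (det_of_tuple_comp_perm fun i j => ⟪x i, e j⟫_ℂ)
      (det_of_tuple_eq_zero fun i j => ⟪x i, e j⟫_ℂ) hA2
    have h3 : ∑' s : {s : Finset I // s.card = k}, principalMinor a s = A / k.factorial := by
      rw [← h2.tsum_eq]
      refine tsum_congr fun s => ?_
      rw [principalMinor_eq_det a (s.1.equivFinOfCardEq s.2).symm]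
      simp only [hxe, ha]
    simp only [h3]
    refine h1.congr_fun fun s => ?_
    simp only [exteriorPower.map_apply_ιMulti, wedgeInner_ιMulti]
    rw [← Matrix.det_transpose]
    rfl
  · exact ((Equiv.sigmaFiberEquiv (Finset.card (α := I))).hasSum_iff.mpr hminor.hasSum).sigma
      fun k => ((hminor.subtype {s : Finset I | s.card = k}).hasSum)

end Nuclear

/-! ### The logarithm of a Fredholm determinant -/

/-! ### Eigenvalues and `log det` for finite matrices. -/

section FiniteTrace

variable {κ : Type*} [Fintype κ] [DecidableEq κ]

-- Split `p` into linear factors: `det` is multiplicative, and `det (M - r)` is, up to sign, the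
-- characteristic polynomial at `r`.
open Polynomial in
theorem Matrix.det_aeval_eq_of_charpoly_eq {K : Type*} [Field K] [IsAlgClosed K]
    {M D : Matrix κ κ K} (h : M.charpoly = D.charpoly) (p : K[X]) :
    (aeval M p).det = (aeval D p).det := by
  have hlin : ∀ (A : Matrix κ κ K) (r : K),
      (aeval A (X - C r)).det = (-1) ^ Fintype.card κ * A.charpoly.eval r := fun A r => by
    rw [Matrix.eval_charpoly, ← Matrix.det_neg]
    congr 1
    simp [Algebra.algebraMap_eq_smul_one, Matrix.smul_one_eq_diagonal, Matrix.scalar_apply]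
  rw [(IsAlgClosed.splits p).eq_prod_roots]
  simp only [map_mul, Matrix.det_mul]
  congr 1
  · simp [Matrix.algebraMap_eq_diagonal]
  · let φ : Matrix κ κ K → K[X] →* K := fun A =>
      Matrix.detMonoidHom.comp ((aeval A : K[X] →ₐ[K] Matrix κ κ K) : K[X] →* Matrix κ κ K)
    change φ M _ = φ D _
    rw [map_multiset_prod, map_multiset_prod, Multiset.map_map, Multiset.map_map]
    congr 1
    refine Multiset.map_congr rfl fun r _ => ?_
    exact (hlin M r).trans (Eq.trans (by rw [h]) (hlin D r).symm)

-- A diagonal matrix with the same characteristic polynomial replaces triangularization: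
-- determinants of polynomials and traces of powers depend on nothing more.
open Polynomial in
theorem Matrix.exists_eigenvalues (M : Matrix κ κ ℂ) :
    ∃ v : κ → ℂ, M.charpoly = (Matrix.diagonal v).charpoly := by
  have hcard : M.charpoly.roots.toList.length = Fintype.card κ := by
    rw [Multiset.length_toList, ← (IsAlgClosed.splits M.charpoly).natDegree_eq_card_roots,
      Matrix.charpoly_natDegree_eq_dim]
  let e : κ ≃ Fin M.charpoly.roots.toList.length := (Fintype.equivFin κ).trans (finCongr hcard.symm)
  refine ⟨fun i => M.charpoly.roots.toList.get (e i), ?_⟩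
  rw [Matrix.charpoly_diagonal, Equiv.prod_comp e (fun j => X - C (M.charpoly.roots.toList.get j))]
  conv_lhs => rw [(IsAlgClosed.splits M.charpoly).eq_prod_roots,
    (Matrix.charpoly_monic M).leadingCoeff, C_1, one_mul]
  conv_lhs => rw [← Multiset.coe_toList M.charpoly.roots]
  rw [Multiset.map_coe, Multiset.prod_coe, ← List.prod_ofFn]
  congr 1
  exact (List.ofFn_getElem_eq_map _ _).symm

-- The trace of `M ^ m` is the linear coefficient in `s` of `det (1 + s M ^ m)`, and for each `s`
-- this is the determinant of a polynomial in `M`.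
open Polynomial in
theorem Matrix.trace_pow_eq_of_charpoly_eq {K : Type*} [Field K] [IsAlgClosed K]
    {M D : Matrix κ κ K} (h : M.charpoly = D.charpoly) (m : ℕ) :
    (M ^ m).trace = (D ^ m).trace := by
  rw [← Matrix.coeff_det_one_add_X_smul_one, ← Matrix.coeff_det_one_add_X_smul_one]
  congr 1
  have : Infinite K := IsAlgClosed.instInfinite
  refine Polynomial.funext fun s => ?_
  have key : ∀ A : Matrix κ κ K, eval s (1 + (X : K[X]) • (A ^ m).map C).det =
      (aeval A (1 + C s * X ^ m)).det := fun A => by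
    rw [← Polynomial.coe_evalRingHom, RingHom.map_det]
    congr 1
    ext i j
    simp [Matrix.one_apply, apply_ite, Algebra.algebraMap_eq_smul_one, mul_comm s]
  rw [key, key, Matrix.det_aeval_eq_of_charpoly_eq h]

/-- Take `ℓ¹` norms in the equation of an eigenvector. The bound puts all eigenvalues of a small
matrix inside the disc where the logarithm series converges. -/
theorem Matrix.norm_le_of_isRoot_charpoly {M : Matrix κ κ ℂ} {z : ℂ} (hz : M.charpoly.IsRoot z) :
    ‖z‖ ≤ ∑ i, ∑ j, ‖M i j‖ := by
  have h0 : (Matrix.scalar κ z - M).det = 0 := by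
    rw [← Matrix.eval_charpoly]; exact hz
  obtain ⟨v, hv, hMv⟩ := Matrix.exists_mulVec_eq_zero_iff.mpr h0
  have hMv' : ∀ i, z * v i = ∑ j, M i j * v j := fun i => by
    have := congrFun hMv i
    rw [Matrix.sub_mulVec, Matrix.scalar_apply, Pi.sub_apply, Matrix.mulVec_diagonal,
      Pi.zero_apply, sub_eq_zero] at this
    exact this
  have hpos : 0 < ∑ i, ‖v i‖ := by
    obtain ⟨i, hi⟩ := Function.ne_iff.mp hv
    exact Finset.sum_pos' (fun _ _ => norm_nonneg _) ⟨i, Finset.mem_univ _, norm_pos_iff.mpr hi⟩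
  refine le_of_mul_le_mul_right ?_ hpos
  calc ‖z‖ * ∑ i, ‖v i‖ = ∑ i, ‖z * v i‖ := by simp [Finset.mul_sum]
    _ ≤ ∑ i, ∑ j, ‖M i j‖ * ∑ k, ‖v k‖ := by
        refine Finset.sum_le_sum fun i _ => ?_
        rw [hMv']
        refine (norm_sum_le _ _).trans (Finset.sum_le_sum fun j _ => ?_)
        rw [norm_mul]
        gcongr
        exact Finset.single_le_sum (f := fun k => ‖v k‖) (fun _ _ => norm_nonneg _)
          (Finset.mem_univ j)
    _ = _ := by simp only [Finset.sum_mul]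

/-- For a small matrix, `det (1 - M) = exp (-∑ₘ tr Mᵐ / m)`. -/
theorem Matrix.exists_hasSum_trace_pow_det_one_sub {M : Matrix κ κ ℂ}
    (hM : ∑ i, ∑ j, ‖M i j‖ < 1) :
    ∃ L, HasSum (fun m : ℕ => (M ^ m).trace / m) L ∧ (1 - M).det = Complex.exp (-L) := by
  obtain ⟨v, hv⟩ := M.exists_eigenvalues
  have hv1 : ∀ i, ‖v i‖ < 1 := fun i => by
    refine (Matrix.norm_le_of_isRoot_charpoly ?_).trans_lt hM
    rw [hv, Matrix.charpoly_diagonal, Polynomial.IsRoot, Polynomial.eval_prod]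
    exact Finset.prod_eq_zero (Finset.mem_univ i) (by simp)
  refine ⟨∑ i, -Complex.log (1 - v i), ?_, ?_⟩
  -- The terms with `m = 0` are divisions by zero, hence `0` in both series.
  · have h := hasSum_sum (s := Finset.univ) fun i _ => Complex.hasSum_taylorSeries_neg_log (hv1 i)
    refine h.congr_fun fun m => ?_
    rw [Matrix.trace_pow_eq_of_charpoly_eq hv, Matrix.diagonal_pow, Matrix.trace_diagonal,
      Finset.sum_div]
    rfl
  · have h1 := Matrix.det_aeval_eq_of_charpoly_eq hv (1 - Polynomial.X)
    simp only [map_sub, map_one, Polynomial.aeval_X] at h1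
    rw [h1, ← Matrix.diagonal_one, Matrix.diagonal_sub, Matrix.det_diagonal, Finset.sum_neg_distrib,
      neg_neg, Complex.exp_sum]
    refine Finset.prod_congr rfl fun i _ => (Complex.exp_log ?_).symm
    intro h
    have : v i = 1 := (sub_eq_zero.mp h).symm
    simpa [this] using hv1 i

end FiniteTrace

/-! ### Traces of powers as sums over closed paths. -/

section ClosedPaths

variable {I : Type*}

/-- The product of the matrix entries along the path from `x` through `l` to `y`. -/
def pathWeight {R : Type*} [Mul R] (a : I → I → R) : I → List I → I → R
  | x, [], y => a y x
  | x, z :: l, y => a z x * pathWeight a z l y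

/-- The product of the matrix entries along the closed path through `l`. -/
def closedPathWeight {R : Type*} [Mul R] [Zero R] (a : I → I → R) : List I → R
  | [] => 0
  | x :: l => pathWeight a x l x

/-- Each step is charged to the index it enters. A closed path enters every listed index once, which
yields a product over the word. -/
theorem norm_pathWeight_le {a : I → I → ℂ} {r : I → ℝ} (ha : ∀ i j, ‖a i j‖ ≤ r i) (y : I) :
    ∀ (x : I) (l : List I), ‖pathWeight a x l y‖ ≤ r y * (l.map r).prod
  | x, [] => by simpa [pathWeight] using ha y x
  | x, z :: l => by
    rw [pathWeight, norm_mul, List.map_cons, List.prod_cons, mul_left_comm]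
    exact mul_le_mul (ha z x) (norm_pathWeight_le ha y z l) (norm_nonneg _)
      ((norm_nonneg _).trans (ha z x))

theorem norm_closedPathWeight_le {a : I → I → ℂ} {r : I → ℝ} (ha : ∀ i j, ‖a i j‖ ≤ r i) :
    ∀ l : List I, ‖closedPathWeight a l‖ ≤ (l.map r).prod
  | [] => by simp [closedPathWeight]
  | x :: l => by simpa [closedPathWeight] using norm_pathWeight_le ha x x l

theorem tendsto_pathWeight {β : Type*} {f : Filter β} {a : β → I → I → ℂ} {a₀ : I → I → ℂ}
    (h : ∀ i j, Filter.Tendsto (fun n => a n i j) f (nhds (a₀ i j))) (y : I) :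
    ∀ (x : I) (l : List I),
      Filter.Tendsto (fun n => pathWeight (a n) x l y) f (nhds (pathWeight a₀ x l y))
  | x, [] => h y x
  | x, z :: l => (h z x).mul (tendsto_pathWeight h y z l)

theorem tendsto_closedPathWeight {β : Type*} {f : Filter β} {a : β → I → I → ℂ} {a₀ : I → I → ℂ}
    (h : ∀ i j, Filter.Tendsto (fun n => a n i j) f (nhds (a₀ i j))) :
    ∀ l : List I,
      Filter.Tendsto (fun n => closedPathWeight (a n) l) f (nhds (closedPathWeight a₀ l))
  | [] => tendsto_const_nhds
  | x :: l => tendsto_pathWeight h x x l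

theorem pathWeight_map {κ R : Type*} [Mul R] (a : I → I → R) (φ : κ → I) (y : κ) :
    ∀ (x : κ) (l : List κ), pathWeight a (φ x) (l.map φ) (φ y) =
      pathWeight (fun i j => a (φ i) (φ j)) x l y
  | _, [] => rfl
  | x, z :: l => congrArg (a (φ z) (φ x) * ·) (pathWeight_map a φ y z l)

theorem closedPathWeight_map {κ R : Type*} [Mul R] [Zero R] (a : I → I → R) (φ : κ → I) :
    ∀ l : List κ, closedPathWeight a (l.map φ) = closedPathWeight (fun i j => a (φ i) (φ j)) l
  | [] => rfl
  | x :: l => pathWeight_map a φ x x l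

/-- A path with `n` intermediate indices has `n + 1` steps, hence the exponent. -/
theorem sum_pathWeight_ofFn {κ R : Type*} [Fintype κ] [DecidableEq κ] [CommSemiring R]
    (M : Matrix κ κ R) (y : κ) :
    ∀ (n : ℕ) (x : κ), ∑ f : Fin n → κ, pathWeight (fun i j => M i j) x (List.ofFn f) y =
      (M ^ (n + 1)) y x
  | 0, x => by simp [pathWeight]
  | n + 1, x => by
    rw [← (Fin.consEquiv fun _ : Fin (n + 1) => κ).sum_comp, Fintype.sum_prod_type, pow_succ,
      Matrix.mul_apply]
    refine Finset.sum_congr rfl fun z _ => ?_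
    rw [← sum_pathWeight_ofFn M y n z, Finset.sum_mul]
    refine Finset.sum_congr rfl fun f _ => ?_
    simp only [Fin.consEquiv_apply, List.ofFn_succ, Fin.cons_zero, Fin.cons_succ, pathWeight,
      mul_comm]

theorem sum_closedPathWeight_ofFn {κ : Type*} [Fintype κ] [DecidableEq κ]
    (M : Matrix κ κ ℂ) (n : ℕ) :
    ∑ f : Fin (n + 1) → κ, closedPathWeight (fun i j => M i j) (List.ofFn f) =
      (M ^ (n + 1)).trace := by
  rw [← (Fin.consEquiv fun _ : Fin (n + 1) => κ).sum_comp, Fintype.sum_prod_type, Matrix.trace]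
  refine Finset.sum_congr rfl fun x _ => ?_
  rw [Matrix.diag_apply, ← sum_pathWeight_ofFn M x n x]
  refine Finset.sum_congr rfl fun f _ => ?_
  simp only [Fin.consEquiv_apply, List.ofFn_succ, Fin.cons_zero, Fin.cons_succ, closedPathWeight]

/-- The words of length `n` contribute `(∑ r)ⁿ`, so the total is a geometric series. -/
theorem summable_list_prod {r : I → ℝ} (h0 : ∀ i, 0 ≤ r i) (hr : Summable r)
    (h1 : ∑' i, r i < 1) : Summable fun l : List I => (l.map r).prod := by
  rw [← List.equivSigmaTuple.symm.summable_iff]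
  have hn : ∀ n, HasSum (fun f : Fin n → I => (((List.ofFn f)).map r).prod) ((∑' i, r i) ^ n) :=
    fun n => by
      have := (summable_norm_hasSum_prod_tuple (fun _ : Fin n => r) fun _ => by
        simpa [abs_of_nonneg (h0 _)] using hr).2
      simpa [List.map_ofFn, List.prod_ofFn] using this
  refine (summable_sigma_of_nonneg fun p => ?_).mpr ⟨fun n => (hn n).summable, ?_⟩
  · exact List.prod_nonneg fun z hz => by
      obtain ⟨i, -, rfl⟩ := List.mem_map.mp hz
      exact h0 i
  · refine (summable_geometric_of_lt_one (tsum_nonneg h0) h1).congr fun n => ?_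
    exact (hn n).tsum_eq.symm

theorem norm_closedPathWeight_div_length_le {a : I → I → ℂ} {r : I → ℝ}
    (ha : ∀ i j, ‖a i j‖ ≤ r i) (l : List I) :
    ‖closedPathWeight a l / l.length‖ ≤ (l.map r).prod := by
  refine le_trans ?_ (norm_closedPathWeight_le ha l)
  rw [norm_div, Complex.norm_natCast]
  rcases l with _ | ⟨x, l⟩
  · simp [closedPathWeight]
  · exact div_le_self (norm_nonneg _) (by simp)

/-- The logarithm of `det (1 - a)` is minus the sum over all closed paths, each weighted by the
inverse of its length. -/
theorem fredholmDet_neg_eq_exp {a : I → I → ℂ} {R : I → I → ℝ}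
    (hR : Summable fun p : I × I => R p.1 p.2) (ha : ∀ i j, ‖a i j‖ ≤ R i j)
    (h1 : ∑' i, ∑' j, R i j < 1) :
    fredholmDet (-a) = Complex.exp (-∑' l : List I, closedPathWeight a l / l.length) := by
  classical
  have hR0 : ∀ i j, 0 ≤ R i j := fun i j => (norm_nonneg _).trans (ha i j)
  have hr0 : ∀ i, 0 ≤ ∑' j, R i j := fun i => tsum_nonneg (hR0 i)
  have har : ∀ i j, ‖a i j‖ ≤ ∑' j, R i j := fun i j =>
    (ha i j).trans ((hR.prod_factor i).le_tsum j fun _ _ => hR0 _ _)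
  -- Keeping only the rows in `K` kills every closed path that leaves `K` and reduces the
  -- determinant to a finite block; the bounds by `R` persist, so both sides converge as `K` grows.
  let t : Finset I → I → I → ℂ := fun K i j => if i ∈ K then a i j else 0
  have htn : ∀ K i j, ‖t K i j‖ ≤ ‖a i j‖ := fun K i j => by
    simp only [t]; split_ifs <;> simp
  have htt : ∀ i j, Filter.Tendsto (fun K => t K i j) Filter.atTop (nhds (a i j)) := fun i j => by
    refine tendsto_const_nhds.congr' ?_
    filter_upwards [Filter.eventually_ge_atTop {i}] with K hK
    simp [t, hK (Finset.mem_singleton_self i)]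
  have key : ∀ K, fredholmDet (-t K) =
      Complex.exp (-∑' l : List I, closedPathWeight (t K) l / l.length) := fun K => by
    let M : Matrix K K ℂ := Matrix.of fun i j => a i j
    have hM : ∑ i, ∑ j, ‖M i j‖ < 1 := by
      refine lt_of_le_of_lt ?_ h1
      calc ∑ i : K, ∑ j : K, ‖M i j‖ ≤ ∑ i : K, ∑' j, R i j := by
            refine Finset.sum_le_sum fun i _ => ?_
            refine (Finset.sum_le_sum fun (j : K) _ => ha i j).trans ?_
            rw [Finset.sum_coe_sort K (fun j => R i j)]
            exact (hR.prod_factor i).sum_le_tsum _ fun _ _ => hR0 _ _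
        _ ≤ _ := by
            rw [Finset.sum_coe_sort K (fun i => ∑' j, R i j)]
            exact hR.prod.sum_le_tsum _ fun _ _ => hr0 _
    obtain ⟨L, hL, hdet⟩ := Matrix.exists_hasSum_trace_pow_det_one_sub hM
    have h2 : fredholmDet (-t K) = (1 - M).det := by
      rw [fredholmDet_eq_det (-t K) (Function.Embedding.subtype (· ∈ K)), sub_eq_add_neg]
      · congr 2
        ext i j
        simp [t, M]
      · intro i hi j
        have : i ∉ K := fun h => hi ⟨⟨i, h⟩, rfl⟩
        simp [t, this]
    have hrange : ∀ l : List I, l ∉ Set.range (List.map (Subtype.val : K → I)) →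
        closedPathWeight (t K) l / l.length = 0 := by
      intro l hl
      obtain ⟨z, hz, hzK⟩ : ∃ z ∈ l, z ∉ K := by
        by_contra! h
        exact hl ⟨l.attach.map fun z => ⟨z.1, h z.1 z.2⟩, by simp [List.map_map, Function.comp_def]⟩
      have h0 := norm_closedPathWeight_le (a := t K) (r := fun i => if i ∈ K then ∑' j, R i j else 0)
        (fun i j => by
          by_cases hi : i ∈ K
          · simpa [t, hi] using har i j
          · simp [t, hi]) l
      rw [List.prod_eq_zero (List.mem_map.mpr ⟨z, hz, by simp [hzK]⟩)] at h0
      rw [norm_le_zero_iff.mp h0, zero_div]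
    have hsK : Summable fun l : List K => closedPathWeight (fun i j => M i j) l / l.length := by
      refine Summable.of_norm_bounded (g := fun l : List K => (l.map fun i : K => ∑' j, R i j).prod)
        (summable_list_prod (fun i => hr0 i) (hR.prod.subtype _) ?_)
        (norm_closedPathWeight_div_length_le fun i j => har i j)
      refine lt_of_le_of_lt ?_ h1
      exact hR.prod.tsum_subtype_le _ _ (fun i => hr0 i)
    have h3 : ∑' l : List I, closedPathWeight (t K) l / l.length = L := by
      rw [← (List.map_injective_iff.mpr (Subtype.val_injective (p := (· ∈ K)))).tsum_eq
        (Function.support_subset_iff'.mpr hrange)]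
      have e1 : ∀ l : List K, closedPathWeight (t K) (l.map Subtype.val) / (l.map Subtype.val).length
          = closedPathWeight (fun i j => M i j) l / l.length := fun l => by
        rw [closedPathWeight_map, List.length_map]
        congr 2
        ext i j
        simp [t, M]
      rw [tsum_congr e1]
      -- Grouped by length, the words give the series of `tr Mⁿ / n`; length zero contributes `0`.
      have h4 := (List.equivSigmaTuple.symm.hasSum_iff.mpr hsK.hasSum).sigma
        fun n => hasSum_fintype _
      refine h4.unique (hL.congr_fun fun n => ?_)
      rcases n with _ | n
      · simp
      · rw [← sum_closedPathWeight_ofFn, Finset.sum_div]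
        refine Finset.sum_congr rfl fun f _ => ?_
        simp [List.equivSigmaTuple]
    rw [h2, hdet, h3]
  have hlim1 : Filter.Tendsto (fun K => fredholmDet (-t K)) Filter.atTop (nhds (fredholmDet (-a))) :=
    tendsto_fredholmDet hR (fun K i j => by simpa using (htn K i j).trans (ha i j))
      fun i j => (htt i j).neg
  have hlim2 : Filter.Tendsto (fun K => ∑' l : List I, closedPathWeight (t K) l / l.length)
      Filter.atTop (nhds (∑' l : List I, closedPathWeight a l / l.length)) :=
    tendsto_tsum_of_dominated_convergence (summable_list_prod hr0 hR.prod h1)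
      (fun l => (tendsto_closedPathWeight htt l).div_const _)
      (.of_forall fun K l => norm_closedPathWeight_div_length_le
        (fun i j => (htn K i j).trans (har i j)) l)
  simp only [key] at hlim1
  exact tendsto_nhds_unique hlim1 ((Complex.continuous_exp.tendsto _).comp hlim2.neg)

end ClosedPaths

/-! ### Primitive words and primitive cycles -/

section Words

variable {α : Type*}

/-- The `j`-th power of a word. -/
def wordPow (l : List α) (j : ℕ) : List α := (List.replicate j l).flatten

theorem wordPow_zero (l : List α) : wordPow l 0 = [] := rfl

theorem wordPow_succ (l : List α) (j : ℕ) : wordPow l (j + 1) = l ++ wordPow l j := by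
  simp [wordPow, List.replicate_succ]

theorem wordPow_one (l : List α) : wordPow l 1 = l := by simp [wordPow]

theorem wordPow_add (l : List α) (i j : ℕ) : wordPow l (i + j) = wordPow l i ++ wordPow l j := by
  induction i with
  | zero => simp [wordPow_zero]
  | succ i ih => rw [Nat.add_right_comm, wordPow_succ, ih, wordPow_succ, List.append_assoc]

theorem wordPow_mul (l : List α) (i j : ℕ) : wordPow (wordPow l i) j = wordPow l (i * j) := by
  induction j with
  | zero => rfl
  | succ j ih => rw [wordPow_succ, ih, Nat.mul_succ, Nat.add_comm, wordPow_add]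

theorem length_wordPow (l : List α) (j : ℕ) : (wordPow l j).length = j * l.length := by
  simp [wordPow]

/-- Two commuting words are powers of a common word. -/
theorem exists_eq_wordPow_of_append_comm (r s : List α) (h : r ++ s = s ++ r) :
    ∃ t a b, r = wordPow t a ∧ s = wordPow t b := by
  induction hn : r.length + s.length using Nat.strong_induction_on generalizing r s with
  | _ n ih =>
    wlog hrs : r.length ≤ s.length generalizing r s
    · obtain ⟨t, a, b, h1, h2⟩ := this s r h.symm (by omega) (by omega)
      exact ⟨t, b, a, h2, h1⟩
    rcases eq_or_ne r [] with rfl | hr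
    · exact ⟨s, 0, 1, rfl, (wordPow_one s).symm⟩
    -- The shorter word is a prefix of the longer; cancelling it leaves a shorter commuting pair, as
    -- in the Euclidean algorithm.
    obtain ⟨s', rfl⟩ : r <+: s :=
      List.prefix_of_prefix_length_le (List.prefix_append r s) (h ▸ List.prefix_append s r) hrs
    rw [List.append_assoc] at h
    have hr0 := List.length_pos_iff.mpr hr
    obtain ⟨t, a, b, h1, h2⟩ := ih (r.length + s'.length)
      (by rw [List.length_append] at hn; omega) r s' (List.append_cancel_left h) rfl
    exact ⟨t, a, a + b, h1, by rw [wordPow_add, ← h1, ← h2]⟩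

/-- If `W` is the common power, `W ++ W` begins both with `r ++ s` and with `s ++ r`, which have
equal length. -/
theorem append_comm_of_wordPow_eq {r s : List α} {i j : ℕ}
    (h : wordPow r (i + 1) = wordPow s (j + 1)) : r ++ s = s ++ r := by
  have h1 : wordPow r (i + 1) ++ wordPow r (i + 1) =
      r ++ s ++ (wordPow s j ++ wordPow r i) := by
    rw [wordPow_succ r, List.append_assoc, ← List.append_assoc (wordPow r i)]
    rw [show wordPow r i ++ r = wordPow r (i + 1) by rw [wordPow_add, wordPow_one], h, wordPow_succ]
    simp [List.append_assoc]
  have h2 : wordPow s (j + 1) ++ wordPow s (j + 1) =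
      s ++ r ++ (wordPow r i ++ wordPow s j) := by
    rw [wordPow_succ s, List.append_assoc, ← List.append_assoc (wordPow s j)]
    rw [show wordPow s j ++ s = wordPow s (j + 1) by rw [wordPow_add, wordPow_one], ← h,
      wordPow_succ]
    simp [List.append_assoc]
  rw [h, h2] at h1
  exact ((List.append_inj h1 (by simp [Nat.add_comm])).1).symm

/-- A word is primitive if it is nonempty and not a proper power. -/
def IsPrimitiveWord (r : List α) : Prop := r ≠ [] ∧ ∀ (l : List α) (j : ℕ), 2 ≤ j → r ≠ wordPow l j

theorem IsPrimitiveWord.eq_of_eq_wordPow {r t : List α} {a : ℕ} (hr : IsPrimitiveWord r)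
    (h : r = wordPow t a) : r = t := by
  rcases a with _ | _ | a
  · exact absurd h hr.1
  · rw [h, wordPow_one]
  · exact absurd h (hr.2 t _ (by omega))

theorem exists_primitive_root (l : List α) (hl : l ≠ []) :
    ∃ r j, IsPrimitiveWord r ∧ wordPow r (j + 1) = l := by
  induction hn : l.length using Nat.strong_induction_on generalizing l with
  | _ n ih =>
    by_cases hp : IsPrimitiveWord l
    · exact ⟨l, 0, hp, wordPow_one l⟩
    · obtain ⟨s, j, hj, rfl⟩ : ∃ s j, 2 ≤ j ∧ l = wordPow s j := by
        simpa [IsPrimitiveWord, hl] using hp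
      have hs : s ≠ [] := by
        rintro rfl
        exact hl (List.length_eq_zero_iff.mp (by simp [length_wordPow]))
      have hs0 := List.length_pos_iff.mpr hs
      obtain ⟨r, i, hr, rfl⟩ := ih s.length (by rw [← hn, length_wordPow]; nlinarith) s hs rfl
      refine ⟨r, (i + 1) * j - 1, hr, ?_⟩
      rw [wordPow_mul, Nat.sub_add_cancel (by nlinarith)]

/-- Words with a common power commute, hence are powers of one word `t`; primitivity makes both
equal to `t`, and lengths fix the exponent. -/
theorem wordPow_injective :
    Function.Injective fun q : {r : List α // IsPrimitiveWord r} × ℕ => wordPow q.1.1 (q.2 + 1) := by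
  rintro ⟨⟨r, hr⟩, i⟩ ⟨⟨s, hs⟩, j⟩ h
  simp only at h
  obtain ⟨t, a, b, h1, h2⟩ := exists_eq_wordPow_of_append_comm r s (append_comm_of_wordPow_eq h)
  obtain rfl : r = s := (hr.eq_of_eq_wordPow h1).trans (hs.eq_of_eq_wordPow h2).symm
  have := congrArg List.length h
  rw [length_wordPow, length_wordPow] at this
  have := Nat.eq_of_mul_eq_mul_right (List.length_pos_iff.mpr hr.1) this
  simp_all

/-- A nontrivial rotation fixing `r` splits it into two nonempty commuting pieces, so `r` would be a
proper power. -/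
theorem IsPrimitiveWord.rotate_injective {r : List α} (hr : IsPrimitiveWord r) :
    Function.Injective fun i : Fin r.length => r.rotate i := by
  have key : ∀ k, 0 < k → k < r.length → r.rotate k ≠ r := by
    intro k hk0 hk h
    rw [List.rotate_eq_drop_append_take hk.le] at h
    have h' : r.drop k ++ r.take k = r.take k ++ r.drop k := by rw [h, List.take_append_drop]
    obtain ⟨t, a, b, h1, h2⟩ := exists_eq_wordPow_of_append_comm _ _ h'
    have ha : a ≠ 0 := by
      rintro rfl
      have := congrArg List.length h1
      rw [wordPow_zero, List.length_drop, List.length_nil] at this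
      omega
    have hb : b ≠ 0 := by
      rintro rfl
      have := congrArg List.length h2
      rw [wordPow_zero, List.length_take, List.length_nil] at this
      omega
    refine hr.2 t (a + b) (by omega) ?_
    rw [wordPow_add, ← h1, ← h2, h]
  intro i j hij
  wlog hlt : i ≤ j generalizing i j
  · exact (this hij.symm (le_of_not_ge hlt)).symm
  by_contra hne
  have hlt' : (i : ℕ) < j := lt_of_le_of_ne hlt fun h => hne (Fin.ext h)
  refine key (j - i) (by omega) (by omega) ?_
  refine List.rotate_injective i ?_
  simp only at hij ⊢
  rw [List.rotate_rotate, Nat.sub_add_cancel hlt'.le]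
  exact hij.symm

theorem wordPow_append_rotate (a b : List α) (j : ℕ) :
    a ++ wordPow (b ++ a) j = wordPow (a ++ b) j ++ a := by
  induction j with
  | zero => simp [wordPow_zero]
  | succ j ih => rw [wordPow_succ, wordPow_succ, List.append_assoc, ih]; simp

theorem wordPow_rotate (l : List α) (j n : ℕ) :
    (wordPow l j).rotate n = wordPow (l.rotate n) j := by
  induction n generalizing l with
  | zero => simp
  | succ n ih =>
    rw [Nat.add_comm, ← List.rotate_rotate, ← List.rotate_rotate, ← ih]
    congr 1
    rcases l with _ | ⟨x, t⟩
    · simp [wordPow]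
    rcases j with _ | j
    · simp [wordPow_zero]
    · have h := wordPow_append_rotate [x] t j
      rw [wordPow_succ, List.cons_append, List.rotate_cons_succ, List.rotate_zero,
        List.rotate_cons_succ, List.rotate_zero, wordPow_succ, List.append_assoc,
        List.append_assoc, h]
      rfl

/-- A cycle is primitive if it is nonempty and not a proper power. -/
def IsPrimitiveCycle (c : Cycle α) : Prop :=
  c ≠ Cycle.nil ∧ ¬ ∃ (l : List α) (j : ℕ), 2 ≤ j ∧ c = (wordPow l j : List α)

theorem isPrimitiveCycle_coe {r : List α} : IsPrimitiveCycle (r : Cycle α) ↔ IsPrimitiveWord r := by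
  refine and_congr (not_congr (Cycle.coe_eq_nil r)) ?_
  constructor
  · intro h l j hj hr
    exact h ⟨l, j, hj, by rw [hr]⟩
  · rintro h ⟨l, j, hj, hr⟩
    obtain ⟨n, hn⟩ := (Cycle.coe_eq_coe.mp hr).symm
    exact h (l.rotate n) j hj (by rw [← hn, wordPow_rotate])

/-- A sum over primitive words of a function of the underlying cycle, weighted by the inverse
length, is a sum over primitive cycles. -/
theorem hasSum_primitiveCycle {g : Cycle α → ℂ} {a : ℂ}
    (h : HasSum (fun r : {r : List α // IsPrimitiveWord r} => g r.1 / r.1.length) a) :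
    HasSum (fun p : {c : Cycle α // IsPrimitiveCycle c} => g p.1) a := by
  let π : {r : List α // IsPrimitiveWord r} → {c : Cycle α // IsPrimitiveCycle c} :=
    fun r => ⟨r.1, isPrimitiveCycle_coe.mpr r.2⟩
  refine ((Equiv.sigmaFiberEquiv π).hasSum_iff.mpr h).sigma fun p => ?_
  obtain ⟨r, hr⟩ : ∃ r, π r = p := by
    obtain ⟨c, hc⟩ := p
    induction c using Quotient.inductionOn with
    | _ l => exact ⟨⟨l, isPrimitiveCycle_coe.mp hc⟩, rfl⟩
  subst hr
  have hrot : ∀ i, π ⟨r.1.rotate i, isPrimitiveCycle_coe.mp (by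
      rw [Cycle.coe_eq_coe.mpr (List.IsRotated.forall r.1 i)]
      exact isPrimitiveCycle_coe.mpr r.2)⟩ = π r := fun i =>
    Subtype.ext (Cycle.coe_eq_coe.mpr (List.IsRotated.forall r.1 i))
  -- The fibre over a primitive cycle consists of exactly `r.length` rotations, which cancels the
  -- weight `1 / r.length`.
  let e : Fin r.1.length ≃ {s // π s = π r} := Equiv.ofBijective (fun i => ⟨_, hrot i⟩) <| by
    constructor
    · intro i j hij
      exact r.2.rotate_injective (congrArg (fun s => s.1.1) hij)
    · rintro ⟨⟨s, hs⟩, h⟩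
      obtain ⟨n, hn⟩ : r.1 ~r s := (Cycle.coe_eq_coe.mp (congrArg Subtype.val h)).symm
      have hpos := List.length_pos_iff.mpr r.2.1
      refine ⟨⟨n % r.1.length, Nat.mod_lt _ hpos⟩, ?_⟩
      refine Subtype.ext (Subtype.ext ?_)
      change r.1.rotate (n % r.1.length) = s
      rw [List.rotate_mod, hn]
  refine e.hasSum_iff.mp ?_
  have hc : ∀ s : {s // π s = π r}, g s.1.1 / s.1.1.length = g r.1 / r.1.length := fun s => by
    have h1 : ((s.1.1 : List α) : Cycle α) = r.1 := congrArg Subtype.val s.2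
    rw [h1, (Cycle.coe_eq_coe.mp h1).perm.length_eq]
  have h2 := hasSum_fintype fun _ : Fin r.1.length => g r.1 / (r.1.length : ℂ)
  rw [Finset.sum_const, Finset.card_univ, Fintype.card_fin, nsmul_eq_mul, mul_div_cancel₀ _
    (by exact_mod_cast (List.length_pos_iff.mpr r.2.1).ne')] at h2
  exact h2.congr_fun fun i => hc (e i)

/-- The logarithm of the Euler product over primitive cycles is the sum over all words, each
weighted by the inverse of its length. -/
theorem hasSum_neg_log_primitiveCycle {ω : Cycle α → ℂ}
    (hpow : ∀ (l : List α) (j : ℕ), l ≠ [] → ω (wordPow l (j + 1) : List α) = ω l ^ (j + 1))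
    (h1 : ∀ l : List α, l ≠ [] → ‖ω l‖ < 1)
    (hs : Summable fun l : List α => ω l / l.length) :
    HasSum (fun p : {c : Cycle α // IsPrimitiveCycle c} => -Complex.log (1 - ω p.1))
      (∑' l : List α, ω l / l.length) := by
  refine hasSum_primitiveCycle (g := fun c => -Complex.log (1 - ω c)) ?_
  have hz : ∀ l ∉ Set.range fun q : {r : List α // IsPrimitiveWord r} × ℕ =>
      wordPow q.1.1 (q.2 + 1), ω l / l.length = 0 := by
    intro l hl
    rcases eq_or_ne l [] with rfl | hne
    · simp
    · obtain ⟨r, j, hr, h⟩ := exists_primitive_root l hne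
      exact absurd ⟨(⟨r, hr⟩, j), h⟩ hl
  refine ((wordPow_injective.hasSum_iff hz).mpr hs.hasSum).prod_fiberwise fun r => ?_
  -- The zero-th term vanishes and is dropped, so that index `j` matches the power `j + 1` of the
  -- primitive word.
  have h2 := (hasSum_nat_add_iff' 1).mpr (Complex.hasSum_taylorSeries_neg_log (h1 r.1 r.2.1))
  simp only [Finset.sum_range_one, Nat.cast_zero, div_zero, sub_zero] at h2
  refine (h2.div_const (r.1.length : ℂ)).congr_fun fun j => ?_
  simp only [Function.comp, hpow r.1 j r.2.1, length_wordPow, Nat.cast_mul, div_div]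

end Words

/-! ### Bass' determinant identity for a weighted graph -/

/-- Outer unipotent factors with corners `-(τ - uτJ)` and `τ` have determinant one; the middle
factor is lower triangular with diagonal `1`, `1 - u(στ - J)`. -/
theorem Matrix.det_one_add_bassBlocks {n m R : Type*} [Fintype n] [Fintype m] [DecidableEq n]
    [DecidableEq m] [CommRing R] (τ : Matrix n m R) (σ : Matrix m n R) (J : Matrix m m R) (u : R) :
    (1 + Matrix.fromBlocks (u • (u • (τ * (J * σ)) - τ * σ)) (u • u • (τ * (J * J)))
      (u • σ) (u • J)).det = (1 + -(u • (σ * τ - J))).det := by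
  have h : 1 + Matrix.fromBlocks (u • (u • (τ * (J * σ)) - τ * σ)) (u • u • (τ * (J * J)))
      (u • σ) (u • J) =
      Matrix.fromBlocks 1 (-(τ - u • (τ * J))) 0 1 *
        Matrix.fromBlocks 1 0 (u • σ) (1 + -(u • (σ * τ - J))) * Matrix.fromBlocks 1 τ 0 1 := by
    rw [← Matrix.fromBlocks_one, Matrix.fromBlocks_add, Matrix.fromBlocks_multiply,
      Matrix.fromBlocks_multiply]
    congr 1
    · simp [Matrix.sub_mul, Matrix.mul_assoc, smul_sub]
    · simp [Matrix.sub_mul, Matrix.mul_sub, Matrix.mul_add, Matrix.add_mul, Matrix.mul_assoc,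
        smul_sub]; abel
    · simp
    · simp [smul_sub]; abel
  rw [h, Matrix.det_mul, Matrix.det_mul, Matrix.det_fromBlocks_zero₂₁, Matrix.det_fromBlocks_zero₂₁,
    Matrix.det_fromBlocks_zero₁₂]
  simp

theorem summable_sum_prod_sum {α β : Type*} {R : α ⊕ β → α ⊕ β → ℝ}
    (h₁₁ : Summable fun p : α × α => R (.inl p.1) (.inl p.2))
    (h₁₂ : Summable fun p : α × β => R (.inl p.1) (.inr p.2))
    (h₂₁ : Summable fun p : β × α => R (.inr p.1) (.inl p.2))
    (h₂₂ : Summable fun p : β × β => R (.inr p.1) (.inr p.2)) :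
    Summable fun p : (α ⊕ β) × (α ⊕ β) => R p.1 p.2 := by
  refine (Equiv.sumProdDistrib α β (α ⊕ β)).symm.summable_iff.mp (.sum _ ?_ ?_)
  · exact (Equiv.prodSumDistrib α α β).symm.summable_iff.mp (.sum _ h₁₁ h₁₂)
  · exact (Equiv.prodSumDistrib β α β).symm.summable_iff.mp (.sum _ h₂₁ h₂₂)

namespace WeightedGraph

section

open scoped Classical

variable {V : Type*} (X : WeightedGraph V)

/-- The matrix of `A` for a general weight function. -/
noncomputable def adjEntry (c : X.OE → ℂ) (x' x : V) : ℂ :=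
  if h : X.graph.Adj x x' then c ⟨(x, x'), h⟩ else 0

/-- The matrix of `B₂` for a general weight function. -/
noncomputable def returnEntry (c : X.OE → ℂ) (x' x : V) : ℂ :=
  if x' = x then ∑' e : {e : X.OE // e.fst = x}, c e.1 * c e.1.symm else 0

/-- The block matrix `u (u B₂ - A, u τ J²; σ, J)` for a general weight function. -/
noncomputable def bassMatrix (u : ℂ) (c : X.OE → ℂ) : V ⊕ X.OE → V ⊕ X.OE → ℂ
  | .inl x', .inl x => u * (u * X.returnEntry c x' x - X.adjEntry c x' x)
  | .inl x, .inr e => u * (u * if e.snd = x then c e * c e.symm else 0)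
  | .inr e, .inl x => u * if e.fst = x then c e else 0
  | .inr e', .inr e => u * if e' = e.symm then c e' else 0

/-- The oriented edge `e'` may follow `e` in a path without backtracking. -/
def Follows (e e' : X.OE) : Prop := e.snd = e'.fst ∧ e' ≠ e.symm

/-- The matrix of the edge transfer operator `σ τ - J` for a general weight function. -/
noncomputable def transferMatrix (c : X.OE → ℂ) (e' e : X.OE) : ℂ :=
  if X.Follows e e' then c e' else 0

theorem mul_sum_eq_adjEntry {c : X.OE → ℂ} {F : Finset X.OE} (hc : ∀ e ∉ F, c e = 0) (x' x : V) :
    ∑ e : F, (if e.1.snd = x' then (1 : ℂ) else 0) * (if e.1.fst = x then c e else 0) =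
      X.adjEntry c x' x := by
  rw [Finset.sum_coe_sort F
    (fun e => (if e.snd = x' then (1 : ℂ) else 0) * (if e.fst = x then c e else 0)), adjEntry]
  split_ifs with h
  · rw [Finset.sum_eq_single ⟨(x, x'), h⟩]
    · simp
    · intro e _ he
      by_cases h1 : e.snd = x'
      · by_cases h2 : e.fst = x
        · exact absurd (SimpleGraph.Dart.ext _ _ (Prod.ext h2 h1)) he
        · simp [h2]
      · simp [h1]
    · intro he
      simp [hc _ he]
  · refine Finset.sum_eq_zero fun e _ => ?_
    by_cases h1 : e.snd = x'
    · by_cases h2 : e.fst = x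
      · exact absurd (h1 ▸ h2 ▸ e.adj) h
      · simp [h2]
    · simp [h1]

/-- Row `e'` of `J` meets only the reversed edge; if that edge lies outside `F`, its weight is zero
anyway. The free `f` serves both `J σ` and `J J`. -/
theorem sum_flip_mul {c : X.OE → ℂ} {F : Finset X.OE} (hc : ∀ e ∉ F, c e = 0) (e' : X.OE)
    (f : X.OE → ℂ) :
    ∑ e : F, (if e' = e.1.symm then c e' else 0) * (c e * f e) = c e' * c e'.symm * f e'.symm := by
  rw [Finset.sum_coe_sort F (fun e => (if e' = e.symm then c e' else 0) * (c e * f e)),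
    Finset.sum_eq_single e'.symm]
  · simp [mul_assoc]
  · intro e _ he
    rw [if_neg fun h => he (by rw [h, SimpleGraph.Dart.symm_symm]), zero_mul]
  · intro he
    simp [hc _ he]

theorem sum_eq_returnEntry {c : X.OE → ℂ} {F : Finset X.OE} (hc : ∀ e ∉ F, c e = 0) (x' x : V) :
    ∑ e : F, (if e.1.snd = x' then (1 : ℂ) else 0) *
      (c e * c e.1.symm * if e.1.symm.fst = x then 1 else 0) = X.returnEntry c x' x := by
  rw [Finset.sum_coe_sort F (fun e => (if e.snd = x' then (1 : ℂ) else 0) *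
      (c e * c e.symm * if e.symm.fst = x then 1 else 0)), returnEntry]
  have h1 : ∑' e : {e : X.OE // e.fst = x}, c e.1 * c e.1.symm =
      ∑ e ∈ F, c e * c e.symm * if e.symm.fst = x then 1 else 0 := by
    rw [show ∑' e : {e : X.OE // e.fst = x}, c e.1 * c e.1.symm =
      ∑' e : X.OE, Set.indicator {e : X.OE | e.fst = x} (fun e => c e * c e.symm) e from
        tsum_subtype {e : X.OE | e.fst = x} (fun e => c e * c e.symm),
      ← (Function.Involutive.toPerm _ SimpleGraph.Dart.symm_involutive).tsum_eq, tsum_eq_sum (s := F)]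
    · refine Finset.sum_congr rfl fun e _ => ?_
      simp [Set.indicator_apply, mul_comm]
    · intro e he
      simp [hc e he]
  split_ifs with h
  · rw [h1]
    refine Finset.sum_congr rfl fun e _ => ?_
    subst h
    by_cases h2 : e.snd = x' <;> simp [h2]
  · refine Finset.sum_eq_zero fun e _ => ?_
    by_cases h2 : e.snd = x'
    · simp [h2, h]
    · simp [h2]

/-- Bass' identity for finitely supported weights. -/
theorem fredholmDet_bassMatrix_of_finite (u : ℂ) {c : X.OE → ℂ} {F : Finset X.OE}
    (hc : ∀ e ∉ F, c e = 0) :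
    fredholmDet (X.bassMatrix u c) = fredholmDet (-(u • X.transferMatrix c)) := by
  -- All endpoints of edges of `F`: rows outside `K` and `F` vanish, so both determinants are
  -- finite.
  let K : Finset V := F.image (fun e => e.fst) ∪ F.image fun e => e.snd
  have hfst : ∀ e ∈ F, e.fst ∈ K := fun e he =>
    Finset.mem_union_left _ (Finset.mem_image_of_mem (fun e : X.OE => e.fst) he)
  have hsnd : ∀ e ∈ F, e.snd ∈ K := fun e he =>
    Finset.mem_union_right _ (Finset.mem_image_of_mem (fun e : X.OE => e.snd) he)
  let τ : Matrix K F ℂ := Matrix.of fun x e => if e.1.snd = x then 1 else 0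
  let σ : Matrix F K ℂ := Matrix.of fun e x => if e.1.fst = x then c e else 0
  let J : Matrix F F ℂ := Matrix.of fun e' e => if e'.1 = e.1.symm then c e' else 0
  have hsig : ∀ (e : F) (x : K), σ e x = c e * if e.1.fst = x then 1 else 0 := fun e x => by
    simp [σ]
  have hτσ : ∀ x' x : K, (τ * σ) x' x = X.adjEntry c x' x := fun x' x =>
    X.mul_sum_eq_adjEntry hc x' x
  have hJσ : ∀ (e : F) (x : K),
      (J * σ) e x = c e * c e.1.symm * if e.1.symm.fst = x then 1 else 0 := fun e x => by
    rw [Matrix.mul_apply]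
    simp only [hsig]
    exact X.sum_flip_mul hc e fun e => if e.fst = x then 1 else 0
  have hτJσ : ∀ x' x : K, (τ * (J * σ)) x' x = X.returnEntry c x' x := fun x' x => by
    rw [Matrix.mul_apply]
    simp only [hJσ]
    exact X.sum_eq_returnEntry hc x' x
  have hJJ : ∀ e' e : F, (J * J) e' e = c e'.1 * c e'.1.symm * if e'.1.symm = e.1.symm then 1 else 0 :=
    fun e' e => by
      rw [← X.sum_flip_mul hc e' fun e'' => if e'' = e.1.symm then 1 else 0, Matrix.mul_apply]
      simp [J]
  have hτJJ : ∀ (x : K) (e : F),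
      (τ * (J * J)) x e = if e.1.snd = x then c e * c e.1.symm else 0 := fun x e => by
    rw [Matrix.mul_apply, Finset.sum_eq_single e]
    · simp [hJJ, τ]
    · intro e' _ he
      have : e'.1.symm ≠ e.1.symm := fun h =>
        he (Subtype.ext (SimpleGraph.Dart.symm_involutive.injective h))
      simp [hJJ, this]
    · simp
  -- `σ τ` allows every continuation of `e`, including the reverse edge; subtracting `J` removes
  -- precisely the backtracking.
  have hστ : ∀ e' e : F, (σ * τ - J) e' e = X.transferMatrix c e' e := fun e' e => by
    rw [Matrix.sub_apply, Matrix.mul_apply,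
      Finset.sum_eq_single ⟨e'.1.fst, hfst _ e'.2⟩]
    · simp only [σ, τ, J, Matrix.of_apply, transferMatrix, Follows, if_true]
      by_cases h : e'.1 = e.1.symm
      · simp [h]
      · simp [h]
    · intro x _ hx
      have : e'.1.fst ≠ x := fun h => hx (Subtype.ext h.symm)
      simp [σ, this]
    · simp
  have hrowV : ∀ x ∉ K, ∀ e : X.OE, e.snd = x → c e = 0 := fun x hx e he =>
    hc e fun h => hx (he ▸ hsnd e h)
  have hrowV' : ∀ x ∉ K, ∀ e : X.OE, e.fst = x → c e = 0 := fun x hx e he =>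
    hc e fun h => hx (he ▸ hfst e h)
  rw [fredholmDet_eq_det _
    ((Function.Embedding.subtype (· ∈ K)).sumMap (Function.Embedding.subtype (· ∈ F))),
    fredholmDet_eq_det _ (Function.Embedding.subtype (· ∈ F))]
  · convert Matrix.det_one_add_bassBlocks τ σ J u using 3
    · ext (x' | e') (x | e)
      · simp [bassMatrix, hτσ, hτJσ]
      · simp [bassMatrix, hτJJ]
      · simp [bassMatrix, σ]
      · simp [bassMatrix, J]
    · ext e' e
      simp [← hστ]
  · intro e he e'
    have : c e = 0 := hc e fun h => he ⟨⟨e, h⟩, rfl⟩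
    simp [transferMatrix, this]
  · rintro (x | e) hi j
    · have hx : x ∉ K := fun h => hi ⟨.inl ⟨x, h⟩, rfl⟩
      rcases j with y | e
      · have h1 : X.adjEntry c x y = 0 := by
          unfold adjEntry
          split_ifs with h
          · exact hrowV x hx _ rfl
          · rfl
        have h2 : X.returnEntry c x y = 0 := by
          unfold returnEntry
          split_ifs with h
          · subst h
            simp [fun e : {e : X.OE // e.fst = x} => hrowV' x hx e.1 e.2]
          · rfl
        simp [bassMatrix, h1, h2]
      · simp only [bassMatrix]
        split_ifs with h
        · simp [hrowV x hx e h]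
        · simp
    · have : c e = 0 := hc e fun h => hi ⟨.inr ⟨e, h⟩, rfl⟩
      rcases j with y | e <;> simp [bassMatrix, this]

end

end WeightedGraph

/-! ### Convergence of the graph matrices -/

namespace WeightedGraph

section

open scoped Classical

variable {V : Type*} (X : WeightedGraph V)

/-- The weight function with complex values. -/
noncomputable def cweight (e : X.OE) : ℂ := X.weight e

theorem norm_cweight (e : X.OE) : ‖X.cweight e‖ = X.weight e := by
  rw [cweight, Complex.norm_real, Real.norm_of_nonneg (X.weight_pos e).le]

/-- The weight function cut off to a finite set of oriented edges. -/
noncomputable def cutWeight (F : Finset X.OE) (e : X.OE) : ℂ := if e ∈ F then X.cweight e else 0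

theorem norm_cutWeight_le (F : Finset X.OE) (e : X.OE) : ‖X.cutWeight F e‖ ≤ X.weight e := by
  unfold cutWeight
  split_ifs
  · exact (X.norm_cweight e).le
  · simpa using (X.weight_pos e).le

theorem tendsto_cutWeight (e : X.OE) :
    Filter.Tendsto (fun F => X.cutWeight F e) Filter.atTop (nhds (X.cweight e)) := by
  refine tendsto_const_nhds.congr' ?_
  filter_upwards [Filter.eventually_ge_atTop {e}] with F hF
  simp [cutWeight, hF (Finset.mem_singleton_self e)]

theorem summable_weight_mul_symm : Summable fun e : X.OE => X.weight e * X.weight e.symm := by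
  refine Summable.of_nonneg_of_le (fun e => (mul_pos (X.weight_pos _) (X.weight_pos _)).le)
    (fun e => ?_) (X.summable_weight.mul_right (∑' e, X.weight e))
  exact mul_le_mul_of_nonneg_left (X.summable_weight.le_tsum _ fun e _ => (X.weight_pos e).le)
    (X.weight_pos e).le

theorem summable_weight_mul_symm_fst (x : V) :
    Summable fun e : {e : X.OE // e.fst = x} => X.weight e.1 * X.weight e.1.symm :=
  X.summable_weight_mul_symm.subtype {e : X.OE | e.fst = x}

/-- An entrywise bound for all matrices `bassMatrix u c` with `‖c‖ ≤ weight`. -/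
noncomputable def bassBound (u : ℂ) : V ⊕ X.OE → V ⊕ X.OE → ℝ
  | .inl x', .inl x => ‖u‖ * (‖u‖ * (if x' = x then
        ∑' e : {e : X.OE // e.fst = x}, X.weight e.1 * X.weight e.1.symm else 0) +
      if h : X.graph.Adj x x' then X.weight ⟨(x, x'), h⟩ else 0)
  | .inl x, .inr e => ‖u‖ * (‖u‖ * if e.snd = x then X.weight e * X.weight e.symm else 0)
  | .inr e, .inl x => ‖u‖ * if e.fst = x then X.weight e else 0
  | .inr e', .inr e => ‖u‖ * if e' = e.symm then X.weight e' else 0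

theorem norm_ite_le {p : Prop} [Decidable p] {z : ℂ} {r : ℝ} (h : ‖z‖ ≤ r) :
    ‖if p then z else 0‖ ≤ if p then r else 0 := by
  split_ifs <;> simp [h]

theorem norm_mul_symm_le {c : X.OE → ℂ} (hc : ∀ e, ‖c e‖ ≤ X.weight e) (e : X.OE) :
    ‖c e * c e.symm‖ ≤ X.weight e * X.weight e.symm := by
  rw [norm_mul]
  exact mul_le_mul (hc _) (hc _) (norm_nonneg _) (X.weight_pos e).le

theorem norm_bassMatrix_le (u : ℂ) {c : X.OE → ℂ} (hc : ∀ e, ‖c e‖ ≤ X.weight e) :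
    ∀ i j, ‖X.bassMatrix u c i j‖ ≤ X.bassBound u i j
  | .inl x', .inl x => by
    have h1 : ‖X.returnEntry c x' x‖ ≤ if x' = x then
        ∑' e : {e : X.OE // e.fst = x}, X.weight e.1 * X.weight e.1.symm else 0 :=
      norm_ite_le (tsum_of_norm_bounded (X.summable_weight_mul_symm_fst x).hasSum
        fun e => X.norm_mul_symm_le hc e.1)
    have h2 : ‖X.adjEntry c x' x‖ ≤ if h : X.graph.Adj x x' then X.weight ⟨(x, x'), h⟩ else 0 := by
      unfold adjEntry
      split_ifs
      · exact hc _
      · simp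
    simp only [bassMatrix, bassBound, norm_mul]
    refine mul_le_mul_of_nonneg_left ((norm_sub_le _ _).trans (add_le_add ?_ h2)) (norm_nonneg _)
    rw [norm_mul]
    exact mul_le_mul_of_nonneg_left h1 (norm_nonneg _)
  | .inl x, .inr e => by
    simp only [bassMatrix, bassBound, norm_mul u]
    exact mul_le_mul_of_nonneg_left (mul_le_mul_of_nonneg_left
      (norm_ite_le (X.norm_mul_symm_le hc e)) (norm_nonneg _)) (norm_nonneg _)
  | .inr e, .inl x => by
    simp only [bassMatrix, bassBound, norm_mul u]
    exact mul_le_mul_of_nonneg_left (norm_ite_le (hc e)) (norm_nonneg _)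
  | .inr e', .inr e => by
    simp only [bassMatrix, bassBound, norm_mul u]
    exact mul_le_mul_of_nonneg_left (norm_ite_le (hc e')) (norm_nonneg _)

/-- Each piece of the bound lives on the image of an injection from `V` or from the edges, where it
reduces to `∑ w(e)` or `∑ w(e) w(e⁻¹)`. -/
theorem summable_bassBound (u : ℂ) :
    Summable fun p : (V ⊕ X.OE) × (V ⊕ X.OE) => X.bassBound u p.1 p.2 := by
  refine summable_sum_prod_sum ?_ ?_ ?_ ?_
  · simp only [bassBound]
    refine Summable.mul_left _ (Summable.add (Summable.mul_left _ ?_) ?_)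
    · have hinj : Function.Injective fun x : V => (x, x) := fun x y h => congrArg Prod.fst h
      refine (hinj.summable_iff ?_).mp ?_
      · rintro ⟨x', x⟩ h
        exact if_neg fun h' => h ⟨x, by simp at h'; simp [h']⟩
      · simp only [Function.comp_def, if_true]
        exact ((Equiv.sigmaFiberEquiv fun e : X.OE => e.fst).summable_iff.mpr
          X.summable_weight_mul_symm).sigma
    · have hinj : Function.Injective fun e : X.OE => (e.snd, e.fst) := fun e e' h =>
        SimpleGraph.Dart.ext _ _ (Prod.ext (congrArg Prod.snd h) (congrArg Prod.fst h))
      refine (hinj.summable_iff ?_).mp ?_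
      · rintro ⟨x', x⟩ h
        exact dif_neg fun h' => h ⟨⟨(x, x'), h'⟩, rfl⟩
      · refine X.summable_weight.congr fun e => ?_
        simp [e.adj]
  · simp only [bassBound]
    refine Summable.mul_left _ (Summable.mul_left _ ?_)
    have hinj : Function.Injective fun e : X.OE => (e.snd, e) := fun e e' h => congrArg Prod.snd h
    refine (hinj.summable_iff ?_).mp ?_
    · rintro ⟨x, e⟩ h
      exact if_neg fun h' => h ⟨e, by simp at h'; simp [h']⟩
    · simpa [Function.comp_def] using X.summable_weight_mul_symm
  · simp only [bassBound]
    refine Summable.mul_left _ ?_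
    have hinj : Function.Injective fun e : X.OE => (e, e.fst) := fun e e' h => congrArg Prod.fst h
    refine (hinj.summable_iff ?_).mp ?_
    · rintro ⟨e, x⟩ h
      exact if_neg fun h' => h ⟨e, by simp at h'; simp [h']⟩
    · simpa [Function.comp_def] using X.summable_weight
  · simp only [bassBound]
    refine Summable.mul_left _ ?_
    have hinj : Function.Injective fun e : X.OE => (e, e.symm) := fun e e' h => congrArg Prod.fst h
    refine (hinj.summable_iff ?_).mp ?_
    · rintro ⟨e', e⟩ h
      exact if_neg fun h' => h ⟨e', by simp at h'; simp [h']⟩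
    · simpa [Function.comp_def] using X.summable_weight

theorem tendsto_ite_zero {β : Type*} {l : Filter β} {p : Prop} [Decidable p] {f : β → ℂ} {z : ℂ}
    (h : Filter.Tendsto f l (nhds z)) :
    Filter.Tendsto (fun n => if p then f n else 0) l (nhds (if p then z else 0)) := by
  split_ifs
  · exact h
  · exact tendsto_const_nhds

theorem tendsto_cutWeight_mul_symm (e : X.OE) :
    Filter.Tendsto (fun F => X.cutWeight F e * X.cutWeight F e.symm) Filter.atTop
      (nhds (X.cweight e * X.cweight e.symm)) :=
  (X.tendsto_cutWeight e).mul (X.tendsto_cutWeight e.symm)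

theorem tendsto_bassMatrix (u : ℂ) : ∀ i j,
    Filter.Tendsto (fun F => X.bassMatrix u (X.cutWeight F) i j) Filter.atTop
      (nhds (X.bassMatrix u X.cweight i j))
  | .inl x', .inl x => by
    refine Filter.Tendsto.const_mul _ (Filter.Tendsto.sub (Filter.Tendsto.const_mul _ ?_) ?_)
    · refine tendsto_ite_zero (tendsto_tsum_of_dominated_convergence
        (X.summable_weight_mul_symm_fst x) (fun e => X.tendsto_cutWeight_mul_symm e.1)
        (.of_forall fun F e => X.norm_mul_symm_le (X.norm_cutWeight_le F) e.1))
    · unfold adjEntry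
      split_ifs
      · exact X.tendsto_cutWeight _
      · exact tendsto_const_nhds
  | .inl x, .inr e =>
    (tendsto_ite_zero (X.tendsto_cutWeight_mul_symm e)).const_mul _ |>.const_mul _
  | .inr e, .inl x => (tendsto_ite_zero (X.tendsto_cutWeight e)).const_mul _
  | .inr e', .inr e => (tendsto_ite_zero (X.tendsto_cutWeight e')).const_mul _

theorem norm_transferMatrix_le {c : X.OE → ℂ} (hc : ∀ e, ‖c e‖ ≤ X.weight e) (e' e : X.OE) :
    ‖X.transferMatrix c e' e‖ ≤ ‖X.transferMatrix X.cweight e' e‖ := by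
  unfold transferMatrix
  split_ifs
  · rw [X.norm_cweight]; exact hc e'
  · simp

theorem encard_snd_le {M : ℕ} (hM : ∀ x, (X.graph.neighborSet x).encard ≤ M) (x : V) :
    {e : X.OE | e.snd = x}.encard ≤ M := by
  refine le_trans ?_ (hM x)
  refine Set.encard_le_encard_of_injOn (f := fun e : X.OE => e.fst) ?_ ?_
  · intro e he
    obtain rfl : e.snd = x := he
    exact e.adj.symm
  · intro e he e' he' h
    obtain rfl : e.snd = x := he
    have he' : e'.snd = e.snd := he'
    exact SimpleGraph.Dart.ext _ _ (Prod.ext h he'.symm)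

/-- Bounded valency enters here: row `e'` has at most `M` nonzero entries, each of size `w(e')`. -/
theorem summable_transferMatrix :
    Summable fun p : X.OE × X.OE => ‖X.transferMatrix X.cweight p.1 p.2‖ := by
  obtain ⟨M, hM⟩ := X.boundedValency
  have hfin : ∀ x, {e : X.OE | e.snd = x}.Finite := fun x =>
    Set.encard_lt_top_iff.mp ((X.encard_snd_le hM x).trans_lt (ENat.natCast_lt_top M))
  have hzero : ∀ e', ∀ e ∉ (hfin e'.fst).toFinset, ‖X.transferMatrix X.cweight e' e‖ = 0 := by
    intro e' e he
    have : e.snd ≠ e'.fst := by simpa using he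
    simp [transferMatrix, Follows, this]
  refine (summable_prod_of_nonneg fun _ => norm_nonneg _).mpr
    ⟨fun e' => (hasSum_sum_of_ne_finset_zero (hzero e')).summable, ?_⟩
  refine Summable.of_nonneg_of_le (fun e' => tsum_nonneg fun _ => norm_nonneg _) (fun e' => ?_)
    (X.summable_weight.mul_left (M : ℝ))
  rw [tsum_eq_sum (hzero e')]
  have h1 : ∀ e ∈ (hfin e'.fst).toFinset, ‖X.transferMatrix X.cweight e' e‖ ≤ X.weight e' := by
    intro e _
    unfold transferMatrix
    split_ifs
    · exact (X.norm_cweight e').le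
    · simpa using (X.weight_pos e').le
  refine (Finset.sum_le_card_nsmul _ _ _ h1).trans ?_
  rw [nsmul_eq_mul]
  refine mul_le_mul_of_nonneg_right ?_ (X.weight_pos e').le
  have h2 := X.encard_snd_le hM e'.fst
  rw [(hfin e'.fst).encard_eq_coe_toFinset_card] at h2
  exact_mod_cast h2

/-- Bass' identity: the block determinant is the determinant of the edge transfer operator. -/
theorem fredholmDet_bassMatrix (u : ℂ) :
    fredholmDet (X.bassMatrix u X.cweight) = fredholmDet (-(u • X.transferMatrix X.cweight)) := by
  have h1 := tendsto_fredholmDet (X.summable_bassBound u)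
    (fun F => X.norm_bassMatrix_le u (X.norm_cutWeight_le F)) (X.tendsto_bassMatrix u)
  have h2 : Filter.Tendsto (fun F => fredholmDet (-(u • X.transferMatrix (X.cutWeight F))))
      Filter.atTop (nhds (fredholmDet (-(u • X.transferMatrix X.cweight)))) := by
    refine tendsto_fredholmDet (R := fun i j => ‖u‖ * ‖X.transferMatrix X.cweight i j‖)
      (X.summable_transferMatrix.mul_left _) (fun F i j => ?_) fun i j => ?_
    · simp only [Pi.neg_apply, Pi.smul_apply, smul_eq_mul, norm_neg, norm_mul]
      exact mul_le_mul_of_nonneg_left (X.norm_transferMatrix_le (X.norm_cutWeight_le F) i j)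
        (norm_nonneg _)
    · exact (Filter.Tendsto.const_mul _ (tendsto_ite_zero (X.tendsto_cutWeight i))).neg
  have h3 : ∀ F, fredholmDet (X.bassMatrix u (X.cutWeight F)) =
      fredholmDet (-(u • X.transferMatrix (X.cutWeight F))) := fun F =>
    X.fredholmDet_bassMatrix_of_finite u (F := F) fun e he => by simp [cutWeight, he]
  simp only [h3] at h1
  exact tendsto_nhds_unique h1 h2

/-! ### The Euler product -/

/-- The contribution `w(c) u ^ l(c)` of a cyclic sequence of oriented edges, if it is a cycle. -/
noncomputable def eulerWeight (u : ℂ) (c : Cycle X.OE) : ℂ :=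
  if c.Chain X.Follows then (X.cycleWeight c : ℂ) * u ^ c.length else 0

theorem cycleWeight_coe (l : List X.OE) : X.cycleWeight (l : Cycle X.OE) = (l.map X.weight).prod := by
  simp [cycleWeight]

/-- The start `x` carries no weight and the end `y` does, so closing up the path counts every edge
once. -/
theorem pathWeight_transferMatrix (u : ℂ) (y : X.OE) : ∀ (x : X.OE) (l : List X.OE),
    pathWeight (u • X.transferMatrix X.cweight) x l y =
      if (x :: (l ++ [y])).IsChain X.Follows then
        ((X.weight y * (l.map X.weight).prod : ℝ) : ℂ) * u ^ (l.length + 1) else 0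
  | x, [] => by
    simp [pathWeight, transferMatrix, cweight, mul_comm]
  | x, z :: l => by
    rw [pathWeight, pathWeight_transferMatrix u y z l, List.cons_append]
    simp only [List.isChain_cons_cons]
    by_cases h : X.Follows x z
    · simp only [Pi.smul_apply, smul_eq_mul, transferMatrix, cweight, h, if_true, true_and]
      split_ifs
      · simp only [List.map_cons, List.prod_cons, List.length_cons]
        push_cast
        ring
      · simp
    · simp [transferMatrix, h]

theorem closedPathWeight_transferMatrix (u : ℂ) {l : List X.OE} (hl : l ≠ []) :
    closedPathWeight (u • X.transferMatrix X.cweight) l = X.eulerWeight u l := by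
  rcases l with _ | ⟨x, l⟩
  · exact absurd rfl hl
  · rw [closedPathWeight, pathWeight_transferMatrix, eulerWeight, Cycle.chain_coe_cons,
      cycleWeight_coe]
    simp

theorem closedPathWeight_div_length (u : ℂ) (l : List X.OE) :
    closedPathWeight (u • X.transferMatrix X.cweight) l / l.length =
      X.eulerWeight u l / l.length := by
  rcases eq_or_ne l [] with rfl | hl
  · simp
  · rw [X.closedPathWeight_transferMatrix u hl]

/-- The cyclic junctions of a power are those of the word, repeated. -/
theorem chain_wordPow {R : X.OE → X.OE → Prop} {l : List X.OE} (hl : l ≠ []) (j : ℕ) :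
    Cycle.Chain R (wordPow l (j + 1) : List X.OE) ↔ Cycle.Chain R (l : Cycle X.OE) := by
  rcases l with _ | ⟨x, t⟩
  · exact absurd rfl hl
  · induction j with
    | zero => rw [wordPow_one]
    | succ j ih =>
      rw [Cycle.chain_coe_cons] at ih ⊢
      rw [wordPow_succ, List.cons_append, Cycle.chain_coe_cons] at ih ⊢
      rw [List.append_assoc, wordPow_succ, List.cons_append, List.cons_append,
        List.isChain_cons_split, ih, and_self]

theorem eulerWeight_wordPow (u : ℂ) (l : List X.OE) (j : ℕ) (hl : l ≠ []) :
    X.eulerWeight u (wordPow l (j + 1) : List X.OE) = X.eulerWeight u l ^ (j + 1) := by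
  have h : ∀ j, ((wordPow l j).map X.weight).prod = (l.map X.weight).prod ^ j := fun j => by
    simp [wordPow, List.map_flatten, List.prod_flatten]
  unfold eulerWeight
  rw [X.chain_wordPow hl]
  split_ifs
  · rw [cycleWeight_coe, cycleWeight_coe, h, Cycle.length_coe, Cycle.length_coe, length_wordPow,
      mul_pow, ← pow_mul, mul_comm (j + 1)]
    push_cast
    rfl
  · simp

theorem isPrimeCycle_iff (c : Cycle X.OE) :
    X.IsPrimeCycle c ↔ c.Chain X.Follows ∧ IsPrimitiveCycle c :=
  ⟨fun h => ⟨h.1.2, h.1.1, h.2⟩, fun h => ⟨⟨h.2.1, h.1⟩, h.2.2⟩⟩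

/-- The total weight of the entries of the edge transfer matrix. -/
noncomputable def transferTotal : ℝ := ∑' e', ∑' e, ‖X.transferMatrix X.cweight e' e‖

/-- For small `u` the Euler product converges to the exponential of the sum over closed paths,
which is the inverse of the determinant of the edge transfer operator. -/
theorem exists_hasZeta {u : ℂ} (hu : ‖u‖ * X.transferTotal < 1) :
    ∃ z, X.HasZeta u z ∧ z ≠ 0 ∧ fredholmDet (-(u • X.transferMatrix X.cweight)) = z⁻¹ := by
  set a := u • X.transferMatrix X.cweight with ha
  let R : X.OE → X.OE → ℝ := fun i j => ‖u‖ * ‖X.transferMatrix X.cweight i j‖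
  have hR : Summable fun p : X.OE × X.OE => R p.1 p.2 := X.summable_transferMatrix.mul_left _
  have hR0 : ∀ i j, 0 ≤ R i j := fun i j => by positivity
  have haR : ∀ i j, ‖a i j‖ ≤ R i j := fun i j => (norm_mul _ _).le
  have hr0 : ∀ i, 0 ≤ ∑' j, R i j := fun i => tsum_nonneg (hR0 i)
  have har : ∀ i j, ‖a i j‖ ≤ ∑' j, R i j := fun i j =>
    (haR i j).trans ((hR.prod_factor i).le_tsum j fun _ _ => hR0 _ _)
  have h1 : ∑' i, ∑' j, R i j < 1 := by
    simp only [R, tsum_mul_left]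
    exact hu
  have hr1 : ∀ i, ∑' j, R i j < 1 := fun i =>
    (hR.prod.le_tsum i fun _ _ => hr0 _).trans_lt h1
  have hle : ∀ l : List X.OE, (l.map fun i => ∑' j, R i j).prod ≤ 1 := fun l => by
    induction l with
    | nil => simp
    | cons x l ih =>
      rw [List.map_cons, List.prod_cons]
      exact mul_le_one₀ (hr1 x).le (List.prod_nonneg fun z hz => by
        obtain ⟨i, -, rfl⟩ := List.mem_map.mp hz
        exact hr0 i) ih
  have hω1 : ∀ l : List X.OE, l ≠ [] → ‖X.eulerWeight u l‖ < 1 := fun l hl => by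
    rw [← X.closedPathWeight_transferMatrix u hl]
    refine (norm_closedPathWeight_le har l).trans_lt ?_
    rcases l with _ | ⟨x, l⟩
    · exact absurd rfl hl
    · rw [List.map_cons, List.prod_cons]
      exact (mul_le_of_le_one_right (hr0 x) (hle l)).trans_lt (hr1 x)
  have hs : Summable fun l : List X.OE => X.eulerWeight u l / l.length := by
    simp only [← X.closedPathWeight_div_length u]
    exact Summable.of_norm_bounded (summable_list_prod hr0 hR.prod h1)
      (norm_closedPathWeight_div_length_le har)
  have hsum := hasSum_neg_log_primitiveCycle (X.eulerWeight_wordPow u) hω1 hs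
  have hprod : HasProd (fun p : {c : Cycle X.OE // IsPrimitiveCycle c} =>
      (1 - X.eulerWeight u p.1)⁻¹) (Complex.exp (∑' l : List X.OE, X.eulerWeight u l / l.length)) := by
    refine hsum.cexp.congr_fun fun p => ?_
    obtain ⟨c, hc⟩ := p
    induction c using Quotient.inductionOn with
    | _ l =>
      have hl : l ≠ [] := (isPrimitiveCycle_coe.mp hc).1
      have hne : 1 - X.eulerWeight u (l : Cycle X.OE) ≠ 0 := fun h => by
        have := hω1 l hl
        rw [← sub_eq_zero.mp h] at this
        simp at this
      change _ = Complex.exp (-Complex.log (1 - X.eulerWeight u (l : Cycle X.OE)))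
      rw [Complex.exp_neg, Complex.exp_log hne]
      rfl
  refine ⟨_, ?_, Complex.exp_ne_zero (∑' l : List X.OE, X.eulerWeight u l / l.length), ?_⟩
  -- Primitive cyclic words that are not graph cycles have Euler weight `0` and contribute a factor
  -- `1`.
  · let ι : {c : Cycle X.OE // X.IsPrimeCycle c} → {c : Cycle X.OE // IsPrimitiveCycle c} :=
      fun p => ⟨p.1, ((X.isPrimeCycle_iff _).mp p.2).2⟩
    have hι : Function.Injective ι := fun p q h => Subtype.ext (congrArg (fun c => c.1) h)
    refine ((hι.hasProd_iff fun p hp => ?_).mpr hprod).congr_fun fun p => ?_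
    · have : ¬ p.1.Chain X.Follows := fun h => hp ⟨⟨p.1, (X.isPrimeCycle_iff _).mpr ⟨h, p.2⟩⟩, rfl⟩
      simp [eulerWeight, this]
    · simp [ι, eulerWeight, ((X.isPrimeCycle_iff _).mp p.2).1]
  · rw [fredholmDet_neg_eq_exp hR haR h1, Complex.exp_neg,
      tsum_congr (X.closedPathWeight_div_length u)]

theorem isZetaReciprocal_fredholmDet :
    X.IsZetaReciprocal fun u => fredholmDet (-(u • X.transferMatrix X.cweight)) := by
  have hT0 : 0 ≤ X.transferTotal := tsum_nonneg fun _ => tsum_nonneg fun _ => norm_nonneg _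
  -- The added `1` keeps the radius meaningful when the total is zero.
  refine ⟨?_, (X.transferTotal + 1)⁻¹, by positivity, fun u hu => X.exists_hasZeta ?_⟩
  · simp only [← smul_neg]
    exact differentiable_fredholmDet_smul (by simpa using X.summable_transferMatrix)
  · have h := mul_lt_mul_of_pos_right hu (by positivity : 0 < X.transferTotal + 1)
    rw [inv_mul_cancel₀ (by positivity), mul_add, mul_one] at h
    exact (le_add_of_nonneg_right (norm_nonneg u)).trans_lt h

end

end WeightedGraph

/-! ### The block operator -/

theorem EllTwo.hasSum_smul_single {ι : Type*} [DecidableEq ι] (f : EllTwo ι) :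
    HasSum (fun i => f i • (lp.single 2 i 1 : EllTwo ι)) f := by
  refine (lp.hasSum_single (p := 2) (by norm_num) f).congr_fun fun i => ?_
  rw [← lp.single_smul, smul_eq_mul, mul_one]

namespace WeightedGraph

section

open scoped Classical

variable {V : Type*} (X : WeightedGraph V)

/-- The standard orthonormal basis of `C₀ ⊕ C₁`. -/
noncomputable def stdVec : V ⊕ X.OE → X.C₀₁
  | .inl x => WithLp.toLp 2 (lp.single 2 x 1, 0)
  | .inr e => WithLp.toLp 2 (0, lp.single 2 e 1)

/-- The coordinates of a vector of `C₀ ⊕ C₁`. -/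
noncomputable def coord (v : X.C₀₁) : V ⊕ X.OE → ℂ
  | .inl x => v.fst x
  | .inr e => v.snd e

theorem inner_stdVec (v : X.C₀₁) : ∀ i, ⟪X.stdVec i, v⟫_ℂ = X.coord v i
  | .inl x => by simp [stdVec, coord, WithLp.prod_inner_apply, lp.inner_single_left]
  | .inr e => by simp [stdVec, coord, WithLp.prod_inner_apply, lp.inner_single_left]

theorem norm_stdVec_le : ∀ i, ‖X.stdVec i‖ ≤ 1
  | .inl x => by simp [stdVec]
  | .inr e => by simp [stdVec]

theorem hasSum_inner_smul_stdVec (v : X.C₀₁) :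
    HasSum (fun i => ⟪X.stdVec i, v⟫_ℂ • X.stdVec i) v := by
  let L := (WithLp.prodContinuousLinearEquiv 2 ℂ X.C₀ X.C₁).symm.toContinuousLinearMap
  have h1 := (EllTwo.hasSum_smul_single v.fst).mapL (L ∘L ContinuousLinearMap.inl ℂ X.C₀ X.C₁)
  have h2 := (EllTwo.hasSum_smul_single v.snd).mapL (L ∘L ContinuousLinearMap.inr ℂ X.C₀ X.C₁)
  have hv : v = (L ∘L ContinuousLinearMap.inl ℂ X.C₀ X.C₁) v.fst +
      (L ∘L ContinuousLinearMap.inr ℂ X.C₀ X.C₁) v.snd := by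
    apply WithLp.ofLp_injective
    exact Prod.ext (add_zero v.fst).symm (zero_add v.snd).symm
  conv => arg 2; rw [hv]
  refine HasSum.sum (h1.congr_fun fun x => ?_) (h2.congr_fun fun e => ?_)
  · rw [map_smul, Function.comp, inner_stdVec]; rfl
  · rw [map_smul, Function.comp, inner_stdVec]; rfl

theorem block_apply_fst (a : X.C₀ →L[ℂ] X.C₀) (b : X.C₁ →L[ℂ] X.C₀) (c : X.C₀ →L[ℂ] X.C₁)
    (d : X.C₁ →L[ℂ] X.C₁) (v : X.C₀₁) : (X.block a b c d v).fst = a v.fst + b v.snd := rfl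

theorem block_apply_snd (a : X.C₀ →L[ℂ] X.C₀) (b : X.C₁ →L[ℂ] X.C₀) (c : X.C₀ →L[ℂ] X.C₁)
    (d : X.C₁ →L[ℂ] X.C₁) (v : X.C₀₁) : (X.block a b c d v).snd = c v.fst + d v.snd := rfl

theorem J_single (e : X.OE) :
    X.J (lp.single 2 e 1) = X.cweight e.symm • lp.single 2 e.symm (1 : ℂ) := by
  ext e'
  change _ = X.cweight e.symm * (lp.single 2 e.symm (1 : ℂ) : X.C₁) e'
  rw [J, matrixOp_single]
  by_cases h : e' = e.symm
  · simp [flipMatrix, h, cweight]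
  · simp [flipMatrix, h]

/-- `J²` is diagonal; its entries provide the decay of the block `τ J²`, since those of `τ` are only
`0` or `1`. -/
theorem J_J_single (e : X.OE) :
    X.J (X.J (lp.single 2 e 1)) = (X.cweight e * X.cweight e.symm) • lp.single 2 e (1 : ℂ) := by
  rw [J_single, map_smul, J_single, smul_smul, SimpleGraph.Dart.symm_symm, mul_comm]

theorem coord_block_stdVec (u : ℂ) (i j : V ⊕ X.OE) :
    X.coord ((u • X.block (u • X.B₂ - X.A) (u • (X.τ ∘L X.J ∘L X.J)) X.σ X.J) (X.stdVec j)) i =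
      X.bassMatrix u X.cweight i j := by
  rcases j with x | e <;> rcases i with x' | e'
  · change u * (X.block _ _ _ _ _).fst x' = _
    rw [block_apply_fst]
    change u * ((u * X.B₂ (lp.single 2 x 1) x' - X.A (lp.single 2 x 1) x') +
      ((u • (X.τ ∘L X.J ∘L X.J)) (0 : X.C₁)) x') = _
    rw [map_zero, B₂, A, matrixOp_single, matrixOp_single, lp.coeFn_zero, Pi.zero_apply, add_zero]
    rfl
  · change u * (X.block _ _ _ _ _).snd e' = _
    rw [block_apply_snd]
    simp [stdVec, σ, matrixOp_single]
    rfl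
  · change u * (X.block _ _ _ _ _).fst x' = _
    rw [block_apply_fst]
    simp [stdVec, τ, matrixOp_single, J_J_single, bassMatrix, tauMatrix]
  · change u * (X.block _ _ _ _ _).snd e' = _
    rw [block_apply_snd]
    simp [stdVec, J, matrixOp_single]
    rfl

theorem hasFredholmDet_block (u : ℂ) :
    HasFredholmDet (u • X.block (u • X.B₂ - X.A) (u • (X.τ ∘L X.J ∘L X.J)) X.σ X.J)
      (fredholmDet (X.bassMatrix u X.cweight)) :=
  hasFredholmDet_of_summable_entries X.norm_stdVec_le X.hasSum_inner_smul_stdVec _ _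
    (fun i j => by rw [inner_stdVec, coord_block_stdVec])
    (.of_nonneg_of_le (fun _ => norm_nonneg _)
      (fun p => X.norm_bassMatrix_le u (fun e => (X.norm_cweight e).le) p.1 p.2)
      (X.summable_bassBound u))

end

end WeightedGraph

theorem mainTheorem3 {V : Type*} (X : WeightedGraph V) :
    ∃ Zinv : ℂ → ℂ, X.IsZetaReciprocal Zinv ∧
      ∀ u : ℂ, HasFredholmDet
        (u • X.block (u • X.B₂ - X.A) (u • (X.τ ∘L X.J ∘L X.J)) X.σ X.J) (Zinv u) :=
  ⟨_, X.isZetaReciprocal_fredholmDet, fun u =>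
    X.fredholmDet_bassMatrix u ▸ X.hasFredholmDet_block u⟩
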